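/- Let $R$ be a commutative ring, regarded as a discrete ring. For a discrete projective $R$-module $Q$, let $Q^*=\operatorname{Hom}_R(Q,R)$ have the topology whose base of neighbourhoods of $0$ is formed by the annihilators of finite subsets of $Q$. An elementary Tate $R$-module is a topological $R$-module isomorphic to $P\oplus Q^*$ with $P$, $Q$ discrete projective $R$-modules. A Tate $R$-module is a topological $R$-module that is a direct summand of an elementary Tate $R$-module. A lattice in a topological $R$-module $M$ is an open submodule $L\subset M$ such that $L/U$ is finitely generated for every open submodule $U\subset L$; a lattice $L$ is coprojective if $M/L$ is a projective $R$-module. For a commutative $R$-algebra $R'$ and a topological $R$-module $M$, the completed tensor product is the topological $R'$-module $R'\hat\otimes_R M=\varprojlim_U R'\otimes_R(M/U)$, where $U$ runs over the open submodules of $M$ and the modules $R'\otimes_R(M/U)$ are discrete. For a submodule $L\subset M$ with the subspace topology, there is a natural map $R'\hat\otimes_R L\to R'\hat\otimes_R M$. A morphism $\pi:X\to\operatorname{Spec}R$ is a Nisnevich covering if it is étale and there are closed subschemes $\operatorname{Spec}R=F_0\supset F_1\supset\dots\supset F_n=\emptyset$, each defined by finitely many equations, such that $\pi$ has a section over $F_{i-1}\setminus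 F_i$ for $i=1,\dots,n$. **Theorem.** Let $R$ be a commutative ring and let $M$ be a Tate $R$-module. Then $M$ is Nisnevich-locally elementary: there is a commutative $R$-algebra $R'$ such that $\operatorname{Spec}R'\to\operatorname{Spec}R$ is a Nisnevich covering, $R'\hat\otimes_R M$ is an elementary Tate $R'$-module, and $R'\hat\otimes_R M$ has a coprojective lattice $L'$. Moreover, for every lattice $L\subset M$ one can choose $R'$ and a coprojective lattice $L'\subset R'\hat\otimes_R M$, with $\operatorname{Spec}R'\to\operatorname{Spec}R$ a Nisnevich covering, so that $L'$ contains the image of $R'\hat\otimes_R L$. -/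

import Mathlib

open scoped TensorProduct
open AlgebraicGeometry CategoryTheory

universe u v

section Tate

/-- The dual `Q^* = Hom_R(Q, R)` of a discrete `R`-module `Q`. -/
def DiscreteDual (R : Type u) (Q : Type v) [CommRing R] [AddCommGroup Q] [Module R Q] :=
  Q →ₗ[R] R

namespace DiscreteDual

variable (R : Type u) (Q : Type v) [CommRing R] [AddCommGroup Q] [Module R Q]

instance : AddCommGroup (DiscreteDual R Q) := inferInstanceAs (AddCommGroup (Q →ₗ[R] R))

instance : Module R (DiscreteDual R Q) := inferInstanceAs (Module R (Q →ₗ[R] R))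

/-- The topology of pointwise convergence, where `R` is discrete: the annihilators of the finite
subsets of `Q` (equivalently, of the finitely generated submodules) are a base of neighbourhoods
of `0`. -/
instance : TopologicalSpace (DiscreteDual R Q) :=
  TopologicalSpace.induced (fun (f : Q →ₗ[R] R) (q : Q) => f q)
    (@Pi.topologicalSpace Q (fun _ => R) (fun _ => ⊥))

end DiscreteDual

/-- An elementary Tate module: a topological module isomorphic to `P ⊕ Q^*` with `P`, `Q` discrete
projective modules. -/
def IsElementaryTate (R : Type u) (M : Type v) [CommRing R] [AddCommGroup M] [Module R M]
    [TopologicalSpace M] : Prop :=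
  ∃ (P : Type (max u v)) (_ : AddCommGroup P) (_ : Module R P) (_ : TopologicalSpace P)
    (_ : DiscreteTopology P) (_ : Module.Projective R P)
    (Q : Type (max u v)) (_ : AddCommGroup Q) (_ : Module R Q) (_ : Module.Projective R Q),
    Nonempty (M ≃L[R] P × DiscreteDual R Q)

/-- A Tate module: a topological module that is a direct summand of an elementary Tate module. -/
def IsTate (R : Type u) (M : Type v) [CommRing R] [AddCommGroup M] [Module R M]
    [TopologicalSpace M] : Prop :=
  ∃ (N : Type (max u v)) (_ : AddCommGroup N) (_ : Module R N) (_ : TopologicalSpace N)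
    (_ : IsTopologicalAddGroup N) (_ : ContinuousConstSMul R N),
    IsElementaryTate R (M × N)

/-- A lattice: an open submodule `L` such that `L / U` is finitely generated for every open
submodule `U ⊆ L`. -/
def IsLattice {R : Type u} {M : Type v} [CommRing R] [AddCommGroup M] [Module R M]
    [TopologicalSpace M] (L : Submodule R M) : Prop :=
  IsOpen (L : Set M) ∧
    ∀ U : Submodule R M, IsOpen (U : Set M) → U ≤ L → Module.Finite R (L ⧸ U.submoduleOf L)

/-- A coprojective lattice: a lattice with projective quotient. -/
def IsCoprojectiveLattice {R : Type u} {M : Type v} [CommRing R] [AddCommGroup M] [Module R M]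
    [TopologicalSpace M] (L : Submodule R M) : Prop :=
  IsLattice L ∧ Module.Projective R (M ⧸ L)

/-- The open submodules of a topological module. -/
def OpenSubmodule (R : Type u) (M : Type v) [CommRing R] [AddCommGroup M] [Module R M]
    [TopologicalSpace M] : Type v :=
  {U : Submodule R M // IsOpen (U : Set M)}

end Tate

section CompletedTensor

variable (R : Type u) (A : Type u) (M : Type v) [CommRing R] [CommRing A] [Algebra R A]
  [AddCommGroup M] [Module R M] [TopologicalSpace M]

/-- The inverse limit of the modules `A ⊗ (M / U)` over the open submodules `U` of `M`, as the
submodule of compatible families in their product. -/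
def completedTensorSubmodule :
    Submodule A ((U : OpenSubmodule R M) → A ⊗[R] (M ⧸ U.1)) where
  carrier := {x | ∀ (U V : OpenSubmodule R M) (h : U.1 ≤ V.1),
    (Submodule.factor h).baseChange A (x U) = x V}
  add_mem' := by
    intro x y hx hy U V h
    simp only [Pi.add_apply, map_add, hx U V h, hy U V h]
  zero_mem' := by
    intro U V h
    simp only [Pi.zero_apply, map_zero]
  smul_mem' := by
    intro a x hx U V h
    simp only [Pi.smul_apply, map_smul, hx U V h]

/-- The completed tensor product of the discrete algebra `A` with `M`. -/
def CompletedTensor : Type (max u v) := completedTensorSubmodule R A M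

namespace CompletedTensor

instance : AddCommGroup (CompletedTensor R A M) :=
  inferInstanceAs (AddCommGroup (completedTensorSubmodule R A M))

instance : Module A (CompletedTensor R A M) :=
  inferInstanceAs (Module A (completedTensorSubmodule R A M))

/-- The inverse limit topology, each `A ⊗ (M / U)` being discrete. -/
instance : TopologicalSpace (CompletedTensor R A M) :=
  TopologicalSpace.induced
    (fun (x : completedTensorSubmodule R A M) (U : OpenSubmodule R M) => x.1 U)
    (@Pi.topologicalSpace (OpenSubmodule R M) (fun U => A ⊗[R] (M ⧸ U.1)) (fun _ => ⊥))

variable {R M} {N : Type v} [AddCommGroup N] [Module R N] [TopologicalSpace N]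

/-- The preimage of an open submodule under a continuous linear map. -/
def comapOpen (f : N →L[R] M) (U : OpenSubmodule R M) : OpenSubmodule R N :=
  ⟨U.1.comap (f : N →ₗ[R] M), U.2.preimage f.continuous⟩

/-- The map `A ⊗ (N / f⁻¹ U) → A ⊗ (M / U)` induced by `f : N → M`. -/
def mapComponent (f : N →L[R] M) (U : OpenSubmodule R M) :
    A ⊗[R] (N ⧸ (comapOpen f U).1) →ₗ[A] A ⊗[R] (M ⧸ U.1) :=
  (Submodule.mapQ (comapOpen f U).1 U.1 (f : N →ₗ[R] M) le_rfl).baseChange A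

theorem mapComponent_compatible (f : N →L[R] M) (U V : OpenSubmodule R M) (h : U.1 ≤ V.1)
    (h' : (comapOpen f U).1 ≤ (comapOpen f V).1) (z : A ⊗[R] (N ⧸ (comapOpen f U).1)) :
    (Submodule.factor h).baseChange A (mapComponent A f U z) =
      mapComponent A f V ((Submodule.factor h').baseChange A z) := by
  unfold mapComponent
  rw [← LinearMap.comp_apply, ← LinearMap.comp_apply, ← LinearMap.baseChange_comp,
    ← LinearMap.baseChange_comp]
  congr 2
  ext x
  rfl

/-- Functoriality of the completed tensor product: the continuous linear map `f : N → M` induces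
a map `A ⊗̂ N → A ⊗̂ M`. -/
def map (f : N →L[R] M) : CompletedTensor R A N →ₗ[A] CompletedTensor R A M where
  toFun x := ⟨fun U => mapComponent A f U (x.1 (comapOpen f U)), by
    intro U V h
    have h' : (comapOpen f U).1 ≤ (comapOpen f V).1 := Submodule.comap_mono h
    rw [mapComponent_compatible A f U V h h', x.2 (comapOpen f U) (comapOpen f V) h']⟩
  map_add' x y := by
    apply Subtype.ext
    funext U
    exact map_add (mapComponent A f U) (x.1 (comapOpen f U)) (y.1 (comapOpen f U))
  map_smul' a x := by
    apply Subtype.ext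
    funext U
    exact map_smul (mapComponent A f U) a (x.1 (comapOpen f U))

/-- For a submodule `L ⊆ M` with the subspace topology, the image of `A ⊗̂ L` in `A ⊗̂ M`. -/
def ofSubmodule (L : Submodule R M) : Submodule A (CompletedTensor R A M) :=
  LinearMap.range (map A L.subtypeL)

end CompletedTensor

end CompletedTensor

section Nisnevich

/-- For ideals `I`, `J` of `R` with closed subschemes `F = Spec (R / I)` and `V(J)` of `Spec R`:
the open subscheme `F \ V(J)` of `F`. -/
noncomputable def closedDiff {R : Type u} [CommRing R] (I J : Ideal R) :
    (Spec (CommRingCat.of (R ⧸ I))).Opens :=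
  Spec.map (CommRingCat.ofHom (Ideal.Quotient.mk I)) ⁻¹ᵁ
    (⟨(PrimeSpectrum.zeroLocus (J : Set R))ᶜ,
      (PrimeSpectrum.isClosed_zeroLocus (J : Set R)).isOpen_compl⟩ :
      (Spec (CommRingCat.of R)).Opens)

/-- The immersion of `F \ V(J)` in `Spec R`, where `F = Spec (R / I)`. -/
noncomputable def closedDiffHom {R : Type u} [CommRing R] (I J : Ideal R) :
    (closedDiff I J : Scheme.{u}) ⟶ Spec (CommRingCat.of R) :=
  (closedDiff I J).ι ≫ Spec.map (CommRingCat.ofHom (Ideal.Quotient.mk I))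

/-- A Nisnevich covering of `Spec R`: an étale morphism `π : X ⟶ Spec R` such that there are closed
subschemes `Spec R = F 0 ⊇ F 1 ⊇ ... ⊇ F n = ∅`, each one `F i = Spec (R / I i)` defined by finitely
many equations, for which `π` has a section over each `F i \ F (i + 1)`. -/
def IsNisnevichCovering {R : Type u} [CommRing R] {X : Scheme.{u}}
    (π : X ⟶ Spec (CommRingCat.of R)) : Prop :=
  Etale π ∧
    ∃ (n : ℕ) (I : ℕ → Ideal R), I 0 = ⊥ ∧ I n = ⊤ ∧ (∀ i ≤ n, (I i).FG) ∧
      ∀ i < n, I i ≤ I (i + 1) ∧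
        ∃ s : (closedDiff (I i) (I (i + 1)) : Scheme.{u}) ⟶ X,
          s ≫ π = closedDiffHom (I i) (I (i + 1))

end Nisnevich

-- A Tate module is a retract of `P ⊕ R^S`, through maps `α`, `β` out of it and `γ`, `δ` into it
-- (`TateRetract`). The endomorphism `a = αγ` of `P` need not be idempotent, but `a - a² = αδβγ`,
-- and `αδ` has finitely generated image because `δ` is continuous and `P` is discrete. Suppose that
-- `b` is an idempotent of `P` with `ba = b`, `bαδ = 0`, and `a - b` taking values in a finitely
-- generated submodule. Then `ker (bα)` is a coprojective lattice, it is the dual of a projective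
-- module, and `M = range b ⊕ ker (bα)`. So the theorem reduces to correcting an almost idempotent
-- endomorphism of a projective module (`exists_idempotent_of_almost_idempotent`).
--
-- By Cayley-Hamilton there is a monic `f` with `f(a)(a² - a) = 0`. An element `E = X + (X² - X) q`
-- is idempotent modulo `f (X² - X)` as soon as `f ∣ quadPoly q`. The solutions `q` of degree less
-- than `deg f` are represented by `QuadAlgebra f`. This algebra is étale, since the derivative of
-- `quadPoly` in `q` has square `1 + 4 (X² - X) quadPoly q`, hence is invertible at a solution. It
-- has sections over the strata on which the lowest nonzero coefficient of `f` is invertible: there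
-- `f = X^k h` with `h(0)` a unit, and a Bézout relation gives `q`.
--
-- The resulting idempotent need not kill the finitely generated error. A second étale extension
-- (`exists_finite_idempotent`) splits off a part with finitely generated image, and what remains
-- kills any prescribed finitely generated submodule, in particular the image of a given lattice
-- under `α`.

universe w

/-! ### Stratified sections and Nisnevich coverings. -/

/-- `A` has, relative to the closed subset `V(I)`, sections over the strata of a finite
stratification: successively cutting out by further equations `c`, the algebra `A` maps to every
`R`-algebra in which `I` vanishes and `c` is invertible. -/
inductive StratifiedSections (R A : Type u) [CommRing R] [CommRing A] [Algebra R A] :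
    Ideal R → Prop
  | top : StratifiedSections R A ⊤
  | step (I : Ideal R) (c : R) (h : StratifiedSections R A (I ⊔ Ideal.span {c}))
      (s : ∀ (D : Type u) [CommRing D] [Algebra R D], (∀ x ∈ I, algebraMap R D x = 0) →
        IsUnit (algebraMap R D c) → Nonempty (A →ₐ[R] D)) : StratifiedSections R A I

namespace StratifiedSections

theorem nonempty_algHom_of_subsingleton (R A D : Type u) [CommRing R] [CommRing A] [Algebra R A]
    [CommRing D] [Algebra R D] [Subsingleton D] : Nonempty (A →ₐ[R] D) :=
  ⟨{ toFun := fun _ => 0, map_one' := Subsingleton.elim _ _, map_mul' := fun _ _ =>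
      Subsingleton.elim _ _, map_zero' := rfl, map_add' := fun _ _ => Subsingleton.elim _ _,
      commutes' := fun _ => Subsingleton.elim _ _ }⟩

/-- The universal `R`-algebra in which `I` vanishes and `c` is invertible. -/
abbrev Stratum {R : Type u} [CommRing R] (I : Ideal R) (c : R) : Type u :=
  Localization.Away (Ideal.Quotient.mk I c)

section Stratum

variable {R : Type u} [CommRing R] (I : Ideal R) (c : R)

theorem Stratum.algebraMap_eq_zero {x : R} (hx : x ∈ I) :
    algebraMap R (Stratum I c) x = 0 := by
  rw [IsScalarTower.algebraMap_apply R (R ⧸ I) (Stratum I c), Ideal.Quotient.algebraMap_eq,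
    Ideal.Quotient.eq_zero_iff_mem.mpr hx, map_zero]

theorem Stratum.isUnit_algebraMap : IsUnit (algebraMap R (Stratum I c) c) := by
  rw [IsScalarTower.algebraMap_apply R (R ⧸ I) (Stratum I c)]
  exact IsLocalization.Away.algebraMap_isUnit (Ideal.Quotient.mk I c)

theorem Stratum.nonempty_algHom (D : Type u) [CommRing D] [Algebra R D]
    (hI : ∀ x ∈ I, algebraMap R D x = 0) (hc : IsUnit (algebraMap R D c)) :
    Nonempty (Stratum I c →ₐ[R] D) := by
  let g : R ⧸ I →+* D := Ideal.Quotient.lift I (algebraMap R D) hI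
  have hg : IsUnit (g (Ideal.Quotient.mk I c)) := by simpa [g] using hc
  refine ⟨{ IsLocalization.Away.lift (Ideal.Quotient.mk I c) hg with commutes' := fun r => ?_ }⟩
  change IsLocalization.Away.lift (Ideal.Quotient.mk I c) hg (algebraMap R (Stratum I c) r) = _
  rw [IsScalarTower.algebraMap_apply R (R ⧸ I) (Stratum I c), IsLocalization.Away.lift_eq]
  simp [g]

theorem Stratum.exists_mul_pow_eq (z : Stratum I c) :
    ∃ (h : R) (n : ℕ), z * algebraMap R (Stratum I c) c ^ n = algebraMap R (Stratum I c) h := by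
  obtain ⟨n, y, hy⟩ := IsLocalization.Away.surj (Ideal.Quotient.mk I c) z
  obtain ⟨h, rfl⟩ := Ideal.Quotient.mk_surjective y
  refine ⟨h, n, ?_⟩
  rw [IsScalarTower.algebraMap_apply R (R ⧸ I) (Stratum I c),
    IsScalarTower.algebraMap_apply R (R ⧸ I) (Stratum I c)]
  exact hy

end Stratum

/-- The stratification of `Spec A` is pulled back along the section `s` to the stratum where `I`
vanishes and `c` is invertible. An equation `d` on `Spec A` becomes a fraction `s d = h / c ^ n`,
which is replaced by an equation over `R`. The closed remainder, where `c` vanishes too, is covered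
by the last hypothesis. -/
theorem refine_stratum {R A A' : Type u} [CommRing R] [CommRing A] [Algebra R A] [CommRing A']
    [Algebra R A'] [Algebra A A'] [IsScalarTower R A A'] {I : Ideal R} {c : R}
    (s : A →ₐ[R] Stratum I c) {J : Ideal A} (hJ : StratifiedSections A A' J) :
    ∀ I' : Ideal R, I ≤ I' → (∀ j ∈ J, s j ∈ I'.map (algebraMap R (Stratum I c))) →
      StratifiedSections R A' (I' ⊔ Ideal.span {c}) → StratifiedSections R A' I' := by
  induction hJ with
  | top =>
    intro I' hI' hs hc
    refine step I' c hc fun D _ _ hD hcD => ?_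
    obtain ⟨b⟩ := Stratum.nonempty_algHom I c D (fun x hx => hD x (hI' hx)) hcD
    have h1 : b (s 1) = 0 := by
      have : I'.map (algebraMap R (Stratum I c)) ≤ RingHom.ker b.toRingHom := by
        rw [Ideal.map_le_iff_le_comap]
        intro x hx
        simpa [RingHom.mem_ker] using hD x hx
      exact this (hs 1 trivial)
    -- The unit ideal of `A` maps to zero in `D`, so this stratum is empty.
    rw [map_one, map_one] at h1
    have : Subsingleton D := subsingleton_of_zero_eq_one h1.symm
    exact nonempty_algHom_of_subsingleton R A' D
  | step J d hJ ψ ih =>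
    intro I' hI' hs hc
    obtain ⟨h, n, hn⟩ := Stratum.exists_mul_pow_eq I c (s d)
    have hu := Stratum.isUnit_algebraMap I c
    -- The factor `c` makes invertibility of the new equation imply that of both `c` and `s d`, and
    -- leaves the closed remainder `I' ⊔ (c)` unchanged.
    refine step I' (h * c) (ih _ (hI'.trans le_sup_left) ?_ ?_) fun D _ _ hD hcD => ?_
    · have key : J ⊔ Ideal.span {d} ≤
          ((I' ⊔ Ideal.span {h * c}).map (algebraMap R (Stratum I c))).comap s.toRingHom := by
        refine sup_le (fun j hj => Ideal.map_mono le_sup_left (hs j hj)) ?_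
        rw [Ideal.span_singleton_le_iff_mem, Ideal.mem_comap]
        have : s d * algebraMap R (Stratum I c) c ^ (n + 1) ∈
            (I' ⊔ Ideal.span {h * c}).map (algebraMap R (Stratum I c)) := by
          rw [pow_succ, ← mul_assoc, hn, ← map_mul]
          exact Ideal.mem_map_of_mem _ (Ideal.mem_sup_right (Ideal.mem_span_singleton_self _))
        exact (Ideal.mul_unit_mem_iff_mem _ (hu.pow _)).mp this
      exact fun j hj => key hj
    · have : I' ⊔ Ideal.span {h * c} ⊔ Ideal.span {c} = I' ⊔ Ideal.span {c} := by
        rw [sup_assoc]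
        congr 1
        rw [sup_eq_right, Ideal.span_singleton_le_span_singleton]
        exact Dvd.intro_left h rfl
      rwa [this]
    · rw [map_mul] at hcD
      have hcD' := isUnit_of_mul_isUnit_right hcD
      obtain ⟨b⟩ := Stratum.nonempty_algHom I c D (fun x hx => hD x (hI' hx)) hcD'
      let _ : Algebra A D := (b.comp s).toRingHom.toAlgebra
      have : IsScalarTower R A D := IsScalarTower.of_algebraMap_eq fun r =>
        ((b.comp s).commutes r).symm
      have hle : I'.map (algebraMap R (Stratum I c)) ≤ RingHom.ker b.toRingHom := by
        rw [Ideal.map_le_iff_le_comap]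
        intro x hx
        simpa [RingHom.mem_ker] using hD x hx
      obtain ⟨t⟩ := ψ D (fun j hj => hle (hs j hj)) (by
        have := congrArg b hn
        rw [map_mul, AlgHom.commutes] at this
        exact isUnit_of_mul_isUnit_left (this ▸ isUnit_of_mul_isUnit_left hcD))
      exact ⟨t.restrictScalars R⟩

theorem trans {R A A' : Type u} [CommRing R] [CommRing A] [Algebra R A] [CommRing A']
    [Algebra R A'] [Algebra A A'] [IsScalarTower R A A'] {I : Ideal R}
    (h : StratifiedSections R A I) (h' : StratifiedSections A A' ⊥) :
    StratifiedSections R A' I := by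
  induction h with
  | top => exact top
  | step I c h φ ih =>
    obtain ⟨s⟩ := φ (Stratum I c) (fun x hx => Stratum.algebraMap_eq_zero I c hx)
      (Stratum.isUnit_algebraMap I c)
    refine refine_stratum s h' I le_rfl ?_ ih
    rintro j rfl
    rw [map_zero]
    exact zero_mem _

/-- Morphisms from any scheme `U` to an affine scheme are ring maps into `Γ(U, ⊤)`, so `φ` applies
to `Γ(U, ⊤)` even if `U` is not affine. A function vanishing at no point of `U` is a unit there. -/
theorem exists_lift {R A : Type u} [CommRing R] [CommRing A] [Algebra R A] {I : Ideal R} {c : R}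
    (φ : ∀ (D : Type u) [CommRing D] [Algebra R D], (∀ x ∈ I, algebraMap R D x = 0) →
      IsUnit (algebraMap R D c) → Nonempty (A →ₐ[R] D))
    (U : Scheme.{u}) (p : U ⟶ Spec (CommRingCat.of R))
    (hI : ∀ x ∈ I, ((Scheme.ΓSpecIso (CommRingCat.of R)).inv ≫ p.appTop).hom x = 0)
    (hc : ∀ y : U, c ∉ (p y).asIdeal) :
    ∃ s : U ⟶ Spec (CommRingCat.of A), s ≫ Spec.map (CommRingCat.ofHom (algebraMap R A)) = p := by
  let g : CommRingCat.of R ⟶ Γ(U, ⊤) := (Scheme.ΓSpecIso (CommRingCat.of R)).inv ≫ p.appTop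
  have hp : U.toSpecΓ ≫ Spec.map g = p := by
    rw [Spec.map_comp, ← Scheme.toSpecΓ_naturality_assoc, toSpecΓ_SpecMap_ΓSpecIso_inv,
      Category.comp_id]
  let _ : Algebra R Γ(U, ⊤) := g.hom.toAlgebra
  have hu : IsUnit (algebraMap R Γ(U, ⊤) c) := by
    have hb : U.basicOpen (g.hom c) = ⊤ := by
      rw [← Scheme.toSpecΓ_preimage_basicOpen, eq_top_iff]
      intro x _
      change g.hom c ∉ (U.toSpecΓ x).asIdeal
      have hx : p x = PrimeSpectrum.comap g.hom (U.toSpecΓ x) := by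
        rw [← hp]
        rfl
      have hx' := hc x
      rw [hx] at hx'
      exact hx'
    refine RingedSpace.isUnit_of_isUnit_germ _ ⊤ (g.hom c) fun x _ => ?_
    refine (U.mem_basicOpen (g.hom c) x trivial).mp ?_
    rw [hb]
    trivial
  obtain ⟨t⟩ := φ Γ(U, ⊤) hI hu
  refine ⟨U.toSpecΓ ≫ Spec.map (CommRingCat.ofHom t.toRingHom), ?_⟩
  rw [Category.assoc, ← Spec.map_comp]
  have : CommRingCat.ofHom (algebraMap R A) ≫ CommRingCat.ofHom t.toRingHom = g := by
    ext x
    exact t.commutes x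
  rw [this]
  exact hp

theorem exists_closedDiff_section {R A : Type u} [CommRing R] [CommRing A] [Algebra R A]
    {I : Ideal R} {c : R}
    (φ : ∀ (D : Type u) [CommRing D] [Algebra R D], (∀ x ∈ I, algebraMap R D x = 0) →
      IsUnit (algebraMap R D c) → Nonempty (A →ₐ[R] D)) :
    ∃ s : (closedDiff I (I ⊔ Ideal.span {c}) : Scheme.{u}) ⟶ Spec (CommRingCat.of A),
      s ≫ Spec.map (CommRingCat.ofHom (algebraMap R A)) =
        closedDiffHom I (I ⊔ Ideal.span {c}) := by
  refine exists_lift φ _ _ ?_ ?_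
  · intro x hx
    have h1 : (Scheme.ΓSpecIso (CommRingCat.of R)).inv ≫
        (closedDiffHom I (I ⊔ Ideal.span {c})).appTop = CommRingCat.ofHom (Ideal.Quotient.mk I) ≫
          (Scheme.ΓSpecIso (CommRingCat.of (R ⧸ I))).inv ≫
            (closedDiff I (I ⊔ Ideal.span {c})).ι.appTop := by
      rw [Scheme.ΓSpecIso_inv_naturality_assoc]
      rfl
    rw [h1, CommRingCat.hom_comp, RingHom.comp_apply, CommRingCat.hom_ofHom,
      Ideal.Quotient.eq_zero_iff_mem.mpr hx, map_zero]
  · intro y hcy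
    refine y.2 ?_
    let q : PrimeSpectrum (R ⧸ I) := y.1
    change ((I ⊔ Ideal.span {c} : Ideal R) : Set R) ⊆ q.asIdeal.comap (Ideal.Quotient.mk I)
    refine sup_le ?_ ((Ideal.span_singleton_le_iff_mem _).mpr hcy)
    intro z hz
    change Ideal.Quotient.mk I z ∈ q.asIdeal
    rw [Ideal.Quotient.eq_zero_iff_mem.mpr hz]
    exact zero_mem _

theorem isNisnevichCovering {R A : Type u} [CommRing R] [CommRing A] [Algebra R A]
    [Algebra.Etale R A] (h : StratifiedSections R A ⊥) :
    IsNisnevichCovering (Spec.map (CommRingCat.ofHom (algebraMap R A))) := by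
  constructor
  · rw [HasRingHomProperty.Spec_iff (P := @Etale)]
    simpa [RingHom.etale_algebraMap] 
  · suffices ∀ I : Ideal R, I.FG → StratifiedSections R A I →
        ∃ (n : ℕ) (J : ℕ → Ideal R), J 0 = I ∧ J n = ⊤ ∧ (∀ i ≤ n, (J i).FG) ∧
          ∀ i < n, J i ≤ J (i + 1) ∧
            ∃ s : (closedDiff (J i) (J (i + 1)) : Scheme.{u}) ⟶ Spec (CommRingCat.of A),
              s ≫ Spec.map (CommRingCat.ofHom (algebraMap R A)) =
                closedDiffHom (J i) (J (i + 1)) from this ⊥ Submodule.fg_bot h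
    intro I hI hS
    induction hS with
    | top => exact ⟨0, fun _ => ⊤, rfl, rfl, fun _ _ => hI, fun i hi => absurd hi (by omega)⟩
    | step I c hS φ ih =>
      obtain ⟨n, J, h0, hn, hfg, hJ⟩ := ih (Submodule.FG.sup hI (Submodule.fg_span_singleton c))
      refine ⟨n + 1, fun k => Nat.casesOn k I J, rfl, hn, ?_, ?_⟩
      · rintro (_ | i) hi
        · exact hI
        · exact hfg i (by omega)
      · rintro (_ | i) hi
        · change I ≤ J 0 ∧ ∃ s : (closedDiff I (J 0) : Scheme.{u}) ⟶ Spec (CommRingCat.of A),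
              s ≫ Spec.map (CommRingCat.ofHom (algebraMap R A)) = closedDiffHom I (J 0)
          rw [h0]
          exact ⟨le_sup_left, exists_closedDiff_section φ⟩
        · exact hJ i (by omega)

end StratifiedSections

/-! ### The étale algebra of solutions of `quadPoly q ≡ 0` modulo a monic polynomial. -/

section QuadraticEquation

open Polynomial

variable {R C : Type*} [CommRing R] [CommRing C]

/-- The polynomial `1 + (2X - 1) q + (X² - X) q²`. Its product with `X² - X` is `E² - E`, where
`E = X + (X² - X) q`. -/
noncomputable def quadPoly (q : C[X]) : C[X] := 1 + (2 * X - 1) * q + (X ^ 2 - X) * q ^ 2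

theorem quadPoly_map (φ : R →+* C) (q : R[X]) : (quadPoly q).map φ = quadPoly (q.map φ) := by
  simp [quadPoly]

theorem dvd_quadPoly_congr {f q q' : C[X]} (h : f ∣ q - q') (hq : f ∣ quadPoly q) :
    f ∣ quadPoly q' := by
  obtain ⟨k, hk⟩ := h
  obtain ⟨l, hl⟩ := hq
  refine ⟨l - k * (2 * X - 1) - k * (X ^ 2 - X) * (q + q'), ?_⟩
  unfold quadPoly at *
  linear_combination hl - ((2 * X - 1) + (X ^ 2 - X) * (q + q')) * hk

/-- One Newton step. The derivative `2 (X² - X) q + (2X - 1)` squares to `1 + 4 (X² - X) quadPoly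
q`, so up to the error `r` it is its own inverse modulo `f`, and `r² = 0` removes the remaining
terms. -/
theorem dvd_quadPoly_newton {f q k r : C[X]} (h : quadPoly q = f * k + r) (hr : r * r = 0) :
    f ∣ quadPoly (q - r * (2 * (X ^ 2 - X) * q + (2 * X - 1))) := by
  refine ⟨k - 4 * (X ^ 2 - X) * r * k, ?_⟩
  unfold quadPoly at *
  linear_combination (1 - 4 * (X ^ 2 - X) * r) * h +
    ((X ^ 2 - X) * (2 * (X ^ 2 - X) * q + (2 * X - 1)) ^ 2 - 4 * (X ^ 2 - X)) * hr

/-- Subtracting the equations leaves the derivative at `q` times `q' - q`, because the quadratic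
term vanishes; the derivative is its own inverse modulo `f`. -/
theorem dvd_sub_of_dvd_quadPoly {f q q' : C[X]} (h : f ∣ quadPoly q) (h' : f ∣ quadPoly q')
    (hd : (q' - q) * (q' - q) = 0) : f ∣ q' - q := by
  obtain ⟨k, hk⟩ := h
  obtain ⟨l, hl⟩ := h'
  refine ⟨(2 * (X ^ 2 - X) * q + (2 * X - 1)) * (l - k) - 4 * (X ^ 2 - X) * k * (q' - q), ?_⟩
  unfold quadPoly at *
  linear_combination (2 * (X ^ 2 - X) * q + (2 * X - 1)) * (hl - hk) -
    4 * (X ^ 2 - X) * (q' - q) * hk -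
    (2 * (X ^ 2 - X) * q + (2 * X - 1)) * (X ^ 2 - X) * hd

theorem exists_dvd_quadPoly_of_isUnit {k : ℕ} {h : C[X]} (hu : IsUnit (h.coeff 0)) :
    ∃ q : C[X], X ^ k * h ∣ quadPoly q := by
  have h1 : IsCoprime (X : C[X]) (X - 1) := ⟨1, -1, by ring⟩
  have h2 : IsCoprime (X : C[X]) h := by
    obtain ⟨c, hc⟩ := hu.exists_left_inv
    refine ⟨-Polynomial.C c * h.divX, Polynomial.C c, ?_⟩
    have := h.divX_mul_X_add
    have hc' : Polynomial.C c * Polynomial.C (h.coeff 0) = 1 := by rw [← Polynomial.C_mul, hc,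
      Polynomial.C_1]
    linear_combination hc' - Polynomial.C c * this
  -- With `u X^(k+1) + v (X-1) h = 1`, the element `E = u X^(k+1)` is idempotent modulo `X^(k+1)
  -- (X-1) h`, and it is `0` at `X = 0` and `1` at `X = 1`. Solving `E = X + (X² - X) q` gives the
  -- witness `q`, and `E² - E = -u v X^(k+1) (X-1) h` gives the quotient `-(u v)`. Only coprimality
  -- to `X` is needed of `h`.
  obtain ⟨u, v, huv⟩ := (IsCoprime.mul_right h1 h2).pow_left (m := k + 1)
  refine ⟨-(u * X ^ k + v * h), -(u * v), ?_⟩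
  unfold quadPoly
  rw [pow_succ] at huv
  linear_combination (-(1 - (X - 1) * (u * X ^ k + v * h)) + v * h) * huv

/-- The polynomial of degree `< n` with given coefficients. -/
noncomputable def polyOfVec {n : ℕ} (v : Fin n → C) : C[X] :=
  ∑ i, Polynomial.C (v i) * X ^ (i : ℕ)

theorem polyOfVec_map {n : ℕ} (φ : R →+* C) (v : Fin n → R) :
    (polyOfVec v).map φ = polyOfVec (fun i => φ (v i)) := by
  simp [polyOfVec, Polynomial.map_sum]

theorem coeff_polyOfVec {n : ℕ} (v : Fin n → C) (i : Fin n) : (polyOfVec v).coeff i = v i := by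
  simp [polyOfVec, Polynomial.coeff_X_pow, Fin.val_inj]

theorem degree_polyOfVec_lt {n : ℕ} (v : Fin n → C) : (polyOfVec v).degree < n :=
  Polynomial.degree_sum_fin_lt v

theorem exists_polyOfVec {n : ℕ} {p : C[X]} (hp : p.degree < n) :
    polyOfVec (fun i : Fin n => p.coeff i) = p := by
  ext k
  by_cases hk : k < n
  · exact coeff_polyOfVec _ (⟨k, hk⟩ : Fin n)
  · have hnk : (n : WithBot ℕ) ≤ k := by exact_mod_cast not_lt.mp hk
    rw [Polynomial.coeff_eq_zero_of_degree_lt (hp.trans_le hnk),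
      Polynomial.coeff_eq_zero_of_degree_lt ((degree_polyOfVec_lt _).trans_le hnk)]

/-- The ideal expressing that the polynomial with indeterminate coefficients solves
`quadPoly q ≡ 0` modulo `f`. -/
noncomputable def quadIdeal (f : R[X]) : Ideal (MvPolynomial (Fin f.natDegree) R) :=
  Ideal.span (Set.range fun i : Fin f.natDegree =>
    (quadPoly (polyOfVec MvPolynomial.X) %ₘ f.map (algebraMap R _)).coeff i)

/-- The algebra representing the solutions `q` of `quadPoly q ≡ 0` modulo `f`. -/
abbrev QuadAlgebra (f : R[X]) : Type _ := MvPolynomial (Fin f.natDegree) R ⧸ quadIdeal f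

theorem degree_modByMonic_lt_natDegree {f p : C[X]} (hf : f.Monic) :
    (p %ₘ f).degree < f.natDegree := by
  cases subsingleton_or_nontrivial C
  · rw [Subsingleton.elim (p %ₘ f) 0, Polynomial.degree_zero]
    exact WithBot.bot_lt_coe _
  · exact (Polynomial.degree_modByMonic_lt p hf).trans_le Polynomial.degree_le_natDegree

/-- Division by a monic polynomial commutes with ring maps, and the remainder has no coefficients
beyond those that generate `quadIdeal f`. -/
theorem quadIdeal_le_ker_iff {f : R[X]} (hf : f.Monic) [Algebra R C]
    (φ : MvPolynomial (Fin f.natDegree) R →ₐ[R] C) :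
    quadIdeal f ≤ RingHom.ker φ.toRingHom ↔
      f.map (algebraMap R C) ∣ quadPoly (polyOfVec fun i => φ (MvPolynomial.X i)) := by
  have key : (quadPoly (polyOfVec MvPolynomial.X) %ₘ f.map (algebraMap R _)).map φ.toRingHom =
      quadPoly (polyOfVec fun i => φ (MvPolynomial.X i)) %ₘ f.map (algebraMap R C) := by
    rw [Polynomial.map_modByMonic _ (hf.map _), quadPoly_map, polyOfVec_map, Polynomial.map_map]
    congr 2
    exact φ.comp_algebraMap
  rw [← Polynomial.modByMonic_eq_zero_iff_dvd (hf.map _), ← key, quadIdeal, Ideal.span_le]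
  constructor
  · intro h
    ext k
    rw [Polynomial.coeff_map, Polynomial.coeff_zero]
    by_cases hk : k < f.natDegree
    · exact h ⟨⟨k, hk⟩, rfl⟩
    · rw [Polynomial.coeff_eq_zero_of_degree_lt, map_zero]
      refine (degree_modByMonic_lt_natDegree (hf.map _)).trans_le ?_
      exact_mod_cast (Polynomial.natDegree_map_le).trans (not_lt.mp hk)
  · rintro h _ ⟨i, rfl⟩
    have := congrArg (fun p => Polynomial.coeff p i) h
    simpa using this

theorem QuadAlgebra.dvd_quadPoly {f : R[X]} (hf : f.Monic) [Algebra R C]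
    (φ : QuadAlgebra f →ₐ[R] C) : f.map (algebraMap R C) ∣ quadPoly (polyOfVec fun i =>
      φ (Ideal.Quotient.mk (quadIdeal f) (MvPolynomial.X i))) := by
  refine (quadIdeal_le_ker_iff hf (φ.comp (Ideal.Quotient.mkₐ R (quadIdeal f)))).mp fun x hx => ?_
  change φ (Ideal.Quotient.mk (quadIdeal f) x) = 0
  rw [Ideal.Quotient.eq_zero_iff_mem.mpr hx, map_zero]

theorem QuadAlgebra.exists_algHom {f : R[X]} (hf : f.Monic) [Algebra R C]
    (v : Fin f.natDegree → C) (hv : f.map (algebraMap R C) ∣ quadPoly (polyOfVec v)) :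
    ∃ φ : QuadAlgebra f →ₐ[R] C,
      ∀ i, φ (Ideal.Quotient.mk (quadIdeal f) (MvPolynomial.X i)) = v i := by
  have := (quadIdeal_le_ker_iff hf (MvPolynomial.aeval (R := R) v)).mpr (by simpa using hv)
  exact ⟨Ideal.Quotient.liftₐ (quadIdeal f) (MvPolynomial.aeval v) fun x hx => this hx,
    fun i => MvPolynomial.aeval_X v i⟩

theorem QuadAlgebra.nonempty_algHom {f : R[X]} (hf : f.Monic) [Algebra R C]
    {q : C[X]} (hq : f.map (algebraMap R C) ∣ quadPoly q) : Nonempty (QuadAlgebra f →ₐ[R] C) := by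
  have hd : (q %ₘ f.map (algebraMap R C)).degree < f.natDegree :=
    (degree_modByMonic_lt_natDegree (hf.map _)).trans_le
      (by exact_mod_cast Polynomial.natDegree_map_le)
  obtain ⟨φ, -⟩ := QuadAlgebra.exists_algHom hf (C := C) _ (by
    rw [exists_polyOfVec hd]
    refine dvd_quadPoly_congr ?_ hq
    exact ⟨q /ₘ f.map (algebraMap R C), by
      linear_combination -(Polynomial.modByMonic_add_div q (f.map (algebraMap R C)))⟩)
  exact ⟨φ⟩

theorem mul_self_eq_zero_of_map_eq_zero {I : Ideal C} (hI : I ^ 2 = ⊥) {r : C[X]}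
    (hr : r.map (Ideal.Quotient.mk I) = 0) : r * r = 0 := by
  have h1 : r ∈ I.map Polynomial.C := by
    rw [← Ideal.mk_ker (I := I), ← Polynomial.ker_mapRingHom]
    exact hr
  have h2 := Ideal.mul_mem_mul h1 h1
  rw [← Ideal.map_mul, ← sq, hI, Ideal.map_bot] at h2
  exact h2

/-- Infinitesimal lifting along a square-zero ideal: two lifts agree by `dvd_sub_of_dvd_quadPoly`,
and an arbitrary lift of the coefficients becomes a solution after one Newton step. -/
theorem QuadAlgebra.formallyEtale {R : Type u} [CommRing R] {f : R[X]} (hf : f.Monic) :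
    Algebra.FormallyEtale R (QuadAlgebra f) := by
  rw [Algebra.FormallyEtale.iff_comp_bijective]
  intro B _ _ I hI
  have hfB : (f.map (algebraMap R B)).Monic := hf.map _
  have hfI : (f.map (algebraMap R B)).map (Ideal.Quotient.mk I) =
      f.map (algebraMap R (B ⧸ I)) := by
    rw [Polynomial.map_map]
    rfl
  constructor
  · intro φ ψ h
    have h1 := QuadAlgebra.dvd_quadPoly hf φ
    have h2 := QuadAlgebra.dvd_quadPoly hf ψ
    set q := polyOfVec fun i => φ (Ideal.Quotient.mk (quadIdeal f) (MvPolynomial.X i)) with hq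
    set q' := polyOfVec fun i => ψ (Ideal.Quotient.mk (quadIdeal f) (MvPolynomial.X i)) with hq'
    have hd : (q' - q).map (Ideal.Quotient.mk I) = 0 := by
      rw [Polynomial.map_sub, hq, hq', polyOfVec_map, polyOfVec_map, sub_eq_zero]
      congr 1
      funext i
      exact (DFunLike.congr_fun h (Ideal.Quotient.mk (quadIdeal f) (MvPolynomial.X i))).symm
    have h3 := dvd_sub_of_dvd_quadPoly h1 h2 (mul_self_eq_zero_of_map_eq_zero hI hd)
    have h4 : q' = q := by
      cases subsingleton_or_nontrivial B
      · exact Subsingleton.elim _ _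
      rw [← sub_eq_zero, ← (Polynomial.modByMonic_eq_zero_iff_dvd hfB).mpr h3, eq_comm,
        Polynomial.modByMonic_eq_self_iff hfB]
      refine (Polynomial.degree_sub_le _ _).trans_lt ?_
      rw [Polynomial.degree_eq_natDegree hfB.ne_zero, hf.natDegree_map]
      exact max_lt (degree_polyOfVec_lt _) (degree_polyOfVec_lt _)
    apply Ideal.Quotient.algHom_ext
    apply MvPolynomial.algHom_ext
    intro i
    have := congrArg (fun p => Polynomial.coeff p i) h4
    simp only [hq, hq', coeff_polyOfVec] at this
    exact this.symm
  · intro φ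
    have h1 := QuadAlgebra.dvd_quadPoly hf φ
    choose v hv using fun i => Ideal.Quotient.mk_surjective (I := I)
      (φ (Ideal.Quotient.mk (quadIdeal f) (MvPolynomial.X i)))
    set q := polyOfVec v with hq
    set r := quadPoly q %ₘ f.map (algebraMap R B) with hr
    have hrI : r.map (Ideal.Quotient.mk I) = 0 := by
      rw [hr, Polynomial.map_modByMonic _ hfB, quadPoly_map, hfI,
        Polynomial.modByMonic_eq_zero_iff_dvd (hf.map _), hq, polyOfVec_map]
      simpa [hv] using h1
    have h2 : quadPoly q = f.map (algebraMap R B) * (quadPoly q /ₘ f.map (algebraMap R B)) + r := by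
      rw [hr]
      linear_combination -(Polynomial.modByMonic_add_div (quadPoly q) (f.map (algebraMap R B)))
    have h3 := dvd_quadPoly_newton h2 (mul_self_eq_zero_of_map_eq_zero hI hrI)
    set e := r * (2 * (X ^ 2 - X) * q + (2 * X - 1)) with he
    -- The Newton correction is reduced modulo `f` so that the corrected polynomial keeps degree
    -- below `deg f` and is described by its coefficient vector.
    set e' := e %ₘ f.map (algebraMap R B) with he'
    have h4 : f.map (algebraMap R B) ∣ quadPoly (q - e') := by
      refine dvd_quadPoly_congr ?_ h3
      refine ⟨-(e /ₘ f.map (algebraMap R B)), ?_⟩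
      rw [he']
      linear_combination (Polynomial.modByMonic_add_div e (f.map (algebraMap R B)))
    have he'I : e'.map (Ideal.Quotient.mk I) = 0 := by
      rw [he', Polynomial.map_modByMonic _ hfB, he, Polynomial.map_mul, hrI, zero_mul,
        Polynomial.zero_modByMonic]
    have hdeg : (q - e').degree < f.natDegree := by
      refine (Polynomial.degree_sub_le _ _).trans_lt (max_lt (degree_polyOfVec_lt _) ?_)
      exact (degree_modByMonic_lt_natDegree hfB).trans_le
        (by exact_mod_cast Polynomial.natDegree_map_le)
    obtain ⟨ψ, hψ⟩ := QuadAlgebra.exists_algHom hf (C := B) (fun i => (q - e').coeff i) (by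
      rwa [exists_polyOfVec hdeg])
    refine ⟨ψ, ?_⟩
    apply Ideal.Quotient.algHom_ext
    apply MvPolynomial.algHom_ext
    intro i
    change Ideal.Quotient.mk I (ψ (Ideal.Quotient.mk (quadIdeal f) (MvPolynomial.X i))) =
      φ (Ideal.Quotient.mk (quadIdeal f) (MvPolynomial.X i))
    have h5 : Ideal.Quotient.mk I (e'.coeff i) = 0 := by
      rw [← Polynomial.coeff_map, he'I, Polynomial.coeff_zero]
    rw [hψ, Polynomial.coeff_sub, map_sub, h5, hq, coeff_polyOfVec, hv, sub_zero]

theorem QuadAlgebra.etale {R : Type u} [CommRing R] {f : R[X]} (hf : f.Monic) :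
    Algebra.Etale R (QuadAlgebra f) where
  formallyEtale := QuadAlgebra.formallyEtale hf
  finitePresentation := Algebra.FinitePresentation.quotient
    (Submodule.fg_span (Set.finite_range _))

/-- The `k`-th stratum is the locus where the coefficients of `f` below `k` vanish and the `k`-th is
invertible. The stratification ends after `k = deg f`, since the leading coefficient is `1`. -/
theorem QuadAlgebra.stratifiedSections {R : Type u} [CommRing R] {f : R[X]} (hf : f.Monic) :
    StratifiedSections R (QuadAlgebra f) ⊥ := by
  suffices ∀ m k : ℕ, k + m = f.natDegree + 1 →
      StratifiedSections R (QuadAlgebra f) (Ideal.span (f.coeff '' Set.Iio k)) by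
    simpa using this (f.natDegree + 1) 0 (by omega)
  intro m
  induction m with
  | zero =>
    intro k hk
    have : Ideal.span (f.coeff '' Set.Iio k) = ⊤ :=
      Ideal.eq_top_of_isUnit_mem _ (Ideal.subset_span ⟨f.natDegree, by
        simp only [Set.mem_Iio]; omega, rfl⟩) (by simp [hf.coeff_natDegree])
    rw [this]
    exact .top
  | succ m ih =>
    intro k hk
    refine .step _ (f.coeff k) ?_ ?_
    · rw [← Ideal.span_union, Set.union_singleton, ← Set.image_insert_eq]
      have : insert k (Set.Iio k) = Set.Iio (k + 1) := by
        ext j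
        simp only [Set.mem_insert_iff, Set.mem_Iio]
        omega
      rw [this]
      exact ih (k + 1) (by omega)
    · intro D _ _ h0 hu
      have h1 : X ^ k ∣ f.map (algebraMap R D) := by
        rw [Polynomial.X_pow_dvd_iff]
        intro d hd
        rw [Polynomial.coeff_map]
        exact h0 _ (Ideal.subset_span ⟨d, hd, rfl⟩)
      obtain ⟨h, hh⟩ := h1
      obtain ⟨q, hq⟩ := exists_dvd_quadPoly_of_isUnit (C := D) (k := k) (h := h) (by
        rw [← Polynomial.coeff_map, hh] at hu
        simpa [Polynomial.coeff_X_pow_mul'] using hu)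
      rw [← hh] at hq
      exact QuadAlgebra.nonempty_algHom hf hq

/-- Over a suitable étale algebra with sections over the strata of a finite stratification, the
equation `quadPoly q ≡ 0` modulo a monic polynomial has a solution. -/
theorem exists_etale_dvd_quadPoly {R : Type u} [CommRing R] {f : R[X]} (hf : f.Monic) :
    ∃ (A : Type u) (_ : CommRing A) (_ : Algebra R A), Algebra.Etale R A ∧
      StratifiedSections R A ⊥ ∧ ∃ q : A[X], f.map (algebraMap R A) ∣ quadPoly q :=
  ⟨QuadAlgebra f, inferInstance, inferInstance, QuadAlgebra.etale hf,
    QuadAlgebra.stratifiedSections hf, _, QuadAlgebra.dvd_quadPoly hf (AlgHom.id R _)⟩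

end QuadraticEquation

/-! ### Correcting almost idempotent endomorphisms of projective modules. -/

section AlmostIdempotent

open Polynomial

/-- Étale algebras with sections over the strata of a finite stratification of the base. -/
structure IsStratifiedEtale (R A : Type u) [CommRing R] [CommRing A] [Algebra R A] : Prop where
  etale : Algebra.Etale R A
  sections : StratifiedSections R A ⊥

theorem IsStratifiedEtale.trans {R A A' : Type u} [CommRing R] [CommRing A] [Algebra R A]
    [CommRing A'] [Algebra R A'] [Algebra A A'] [IsScalarTower R A A']
    (h : IsStratifiedEtale R A) (h' : IsStratifiedEtale A A') : IsStratifiedEtale R A' where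
  etale :=
    have := h.etale
    have := h'.etale
    Algebra.Etale.comp R A A'
  sections := h.sections.trans h'.sections

theorem IsStratifiedEtale.isNisnevichCovering {R A : Type u} [CommRing R] [CommRing A]
    [Algebra R A] (h : IsStratifiedEtale R A) :
    IsNisnevichCovering (Spec.map (CommRingCat.ofHom (algebraMap R A))) :=
  have := h.etale
  h.sections.isNisnevichCovering

variable {R : Type u} [CommRing R] {P : Type v} [AddCommGroup P] [Module R P]

theorem Polynomial.aeval_comp_eq_of_comp_eq {W : Type*} [AddCommGroup W] [Module R W]
    {g : W →ₗ[R] P} {a : Module.End R W} {b : Module.End R P} (h : ∀ w, g (a w) = b (g w))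
    (p : R[X]) (w : W) : g (aeval a p w) = aeval b p (g w) := by
  induction p using Polynomial.induction_on generalizing w with
  | C r => simp
  | add p q hp hq => simp [hp, hq]
  | monomial n r hn =>
    rw [pow_succ, ← mul_assoc, map_mul (aeval a) _ X, map_mul (aeval b) _ X, aeval_X, aeval_X,
      Module.End.mul_apply, Module.End.mul_apply, hn, h]

theorem Polynomial.aeval_mem_of_mapsTo {a : Module.End R P} {W : Submodule R P}
    (h : ∀ w ∈ W, a w ∈ W) (p : R[X]) {w : P} (hw : w ∈ W) : aeval a p w ∈ W := by
  have := aeval_comp_eq_of_comp_eq (g := W.subtype) (a := a.restrict h) (b := a)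
    (fun _ => rfl) p ⟨w, hw⟩
  exact this ▸ Subtype.property _

theorem Submodule.FG.exists_monic_aeval_eq_zero {a : Module.End R P} {W : Submodule R P}
    (hW : W.FG) (h : ∀ w ∈ W, a w ∈ W) :
    ∃ f : R[X], f.Monic ∧ ∀ w ∈ W, aeval a f w = 0 := by
  have : Module.Finite R W := Module.Finite.iff_fg.mpr hW
  obtain ⟨f, hf, h0⟩ := LinearMap.exists_monic_and_aeval_eq_zero R (a.restrict h)
  refine ⟨f, hf, fun w hw => ?_⟩
  have := aeval_comp_eq_of_comp_eq (g := W.subtype) (a := a.restrict h) (b := a)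
    (fun _ => rfl) f ⟨w, hw⟩
  rw [h0] at this
  simpa using this.symm

theorem Polynomial.aeval_baseChange {A : Type u} [CommRing A] [Algebra R A] (a : Module.End R P)
    (p : R[X]) : aeval (a.baseChange A) (p.map (algebraMap R A)) = (aeval a p).baseChange A := by
  rw [aeval_map_algebraMap]
  exact aeval_algHom_apply (Module.End.baseChangeHom R A P) a p

theorem LinearMap.baseChange_mem_baseChange {A : Type u} [CommRing A] [Algebra R A]
    {P' : Type*} [AddCommGroup P'] [Module R P'] {g : P →ₗ[R] P'} {W : Submodule R P'}
    {V : Submodule R P}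
    (h : ∀ x ∈ V, g x ∈ W) {x : A ⊗[R] P} (hx : x ∈ V.baseChange A) :
    g.baseChange A x ∈ W.baseChange A := by
  rw [Submodule.baseChange_eq_span] at hx
  induction hx using Submodule.span_induction with
  | mem x hx =>
    obtain ⟨w, hw, rfl⟩ := hx
    simpa using Submodule.tmul_mem_baseChange_of_mem 1 (h w hw)
  | zero => simp
  | add x y _ _ hx hy => rw [map_add]; exact add_mem hx hy
  | smul c x _ hx => rw [map_smul]; exact Submodule.smul_mem _ c hx

theorem Submodule.FG.baseChange_fg (A : Type u) [CommRing A] [Algebra R A] {W : Submodule R P}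
    (hW : W.FG) : (W.baseChange A).FG := by
  obtain ⟨G, rfl⟩ := hW
  rw [Submodule.baseChange_span]
  exact Submodule.fg_span (G.finite_toSet.image _)

/-- A section of the free cover of `P` uses only finitely many basis vectors on a finite generating
set of `F`. -/
theorem exists_finite_factorization [Module.Projective R P] {F : Submodule R P} (hF : F.FG) :
    ∃ (n : ℕ) (k : P →ₗ[R] (Fin n → R)) (j : (Fin n → R) →ₗ[R] P), ∀ x ∈ F, j (k x) = x := by
  classical
  obtain ⟨σ, hσ⟩ := Module.projective_def'.mp ‹Module.Projective R P›
  obtain ⟨G, rfl⟩ := hF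
  let S : Finset P := G.biUnion fun g => (σ g).support
  let e := S.equivFin
  refine ⟨S.card, LinearMap.pi fun i => Finsupp.lapply (e.symm i : P) ∘ₗ σ,
    Fintype.linearCombination R fun i => (e.symm i : P), fun x hx => ?_⟩
  induction hx using Submodule.span_induction with
  | mem x hx =>
    have h1 := LinearMap.congr_fun hσ x
    simp only [LinearMap.comp_apply, LinearMap.id_apply, Finsupp.linearCombination_apply] at h1
    rw [Finsupp.sum_of_support_subset (s := S) _ (Finset.subset_biUnion_of_mem (fun g => (σ g).support) hx) _
      (by simp)] at h1
    rw [Fintype.linearCombination_apply]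
    simp only [LinearMap.pi_apply, LinearMap.comp_apply, Finsupp.lapply_apply]
    refine Eq.trans ?_ h1
    rw [e.symm.sum_comp (fun s : S => σ x s • (s : P)), ← Finset.sum_coe_sort S]
    rfl
  | zero => simp
  | add x y _ _ hx hy => rw [map_add, map_add, hx, hy]
  | smul c x _ hx => rw [map_smul, map_smul, hx]

/-- Locally for the Nisnevich topology, a finitely generated submodule of the range of an
idempotent `a` is contained in the finitely generated range of an idempotent `e ≤ a`. -/
theorem exists_finite_idempotent [Module.Projective R P] {a : Module.End R P} (ha : a * a = a)
    {F : Submodule R P} (hF : F.FG) (haF : ∀ x ∈ F, a x = x) :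
    ∃ (A : Type u) (_ : CommRing A) (_ : Algebra R A), IsStratifiedEtale R A ∧
      ∃ e : Module.End A (A ⊗[R] P), e * e = e ∧ a.baseChange A * e = e ∧
        e * a.baseChange A = e ∧ (∃ K : Submodule A (A ⊗[R] P), K.FG ∧ ∀ x, e x ∈ K) ∧
        ∀ x ∈ F, e (1 ⊗ₜ x) = 1 ⊗ₜ x := by
  obtain ⟨n, k₀, j₀, hjk⟩ := exists_finite_factorization hF
  -- The endomorphism `(a j₀)(k₀ a)` of `P` fixes `F` and factors through `R^n`; Cayley-Hamilton is
  -- applied to the composite in the other order, on `R^n`.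
  obtain ⟨f, hf, hf0⟩ := LinearMap.exists_monic_and_aeval_eq_zero R ((k₀ ∘ₗ a) ∘ₗ (a ∘ₗ j₀))
  obtain ⟨A, _, _, hA, hA', q, hq⟩ := exists_etale_dvd_quadPoly hf
  refine ⟨A, _, _, ⟨hA, hA'⟩, ?_⟩
  let J := (a ∘ₗ j₀).baseChange A
  let K := (k₀ ∘ₗ a).baseChange A
  let α : Module.End A (A ⊗[R] (Fin n → R)) := ((k₀ ∘ₗ a) ∘ₗ (a ∘ₗ j₀)).baseChange A
  have hα : K ∘ₗ J = α := (LinearMap.baseChange_comp _ _).symm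
  have hJ : a.baseChange A ∘ₗ J = J := by
    rw [← LinearMap.baseChange_comp, ← LinearMap.comp_assoc]
    change ((a * a) ∘ₗ j₀).baseChange A = _
    rw [ha]
  have hK : K ∘ₗ a.baseChange A = K := by
    rw [← LinearMap.baseChange_comp, LinearMap.comp_assoc]
    change (k₀ ∘ₗ (a * a)).baseChange A = _
    rw [ha]
  have hα0 : ∀ p : A[X], f.map (algebraMap R A) ∣ p → aeval α p = 0 := by
    rintro _ ⟨p, rfl⟩
    rw [map_mul, Polynomial.aeval_baseChange, hf0, LinearMap.baseChange_zero, zero_mul]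
  -- Here `E = X + (X² - X) q = X k₂`. The middle factor is `p = X k₂²` rather than `k₂`: `E² ≡ E`
  -- modulo `f` yields `p X p ≡ p`, which is what makes `J p(α) K` idempotent when `K J = α`.
  let k₂ : A[X] := 1 + (X - 1) * q
  have hE : aeval α (k₂ * (X * k₂)) * (α * aeval α (k₂ * (X * k₂))) =
      aeval α (k₂ * (X * k₂)) := by
    have h1 := hα0 ((X ^ 2 - X) * quadPoly q * (k₂ * (X * k₂ + 1)))
      (((hq.mul_left _).mul_right _))
    have h2 : (X ^ 2 - X) * quadPoly q * (k₂ * (X * k₂ + 1)) =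
        k₂ * (X * k₂) * (X * (k₂ * (X * k₂))) - k₂ * (X * k₂) := by
      simp only [quadPoly, k₂]
      ring
    rw [h2, map_sub, sub_eq_zero, map_mul, map_mul (aeval α) X, aeval_X] at h1
    exact h1
  refine ⟨J ∘ₗ aeval α (k₂ * (X * k₂)) ∘ₗ K, ?_, ?_, ?_, ⟨LinearMap.range J, ?_, ?_⟩, ?_⟩
  · calc (J ∘ₗ aeval α (k₂ * (X * k₂)) ∘ₗ K) ∘ₗ (J ∘ₗ aeval α (k₂ * (X * k₂)) ∘ₗ K)
        = J ∘ₗ (aeval α (k₂ * (X * k₂)) ∘ₗ (K ∘ₗ J) ∘ₗ aeval α (k₂ * (X * k₂))) ∘ₗ K := rfl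
      _ = J ∘ₗ (aeval α (k₂ * (X * k₂)) * (α * aeval α (k₂ * (X * k₂)))) ∘ₗ K := by rw [hα]; rfl
      _ = _ := by rw [hE]
  · change (a.baseChange A ∘ₗ J) ∘ₗ aeval α (k₂ * (X * k₂)) ∘ₗ K = _
    rw [hJ]
  · change J ∘ₗ aeval α (k₂ * (X * k₂)) ∘ₗ (K ∘ₗ a.baseChange A) = _
    rw [hK]
  · exact Module.Finite.iff_fg.mp inferInstance
  · exact fun x => ⟨_, rfl⟩
  · intro x hx
    have hJK : J (K (1 ⊗ₜ x)) = 1 ⊗ₜ x := by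
      simp [J, K, haF x hx, hjk x hx]
    have hv : α (K (1 ⊗ₜ x)) = K (1 ⊗ₜ x) := by
      rw [← hα, LinearMap.comp_apply, hJK]
    -- On `K (1 ⊗ x)` the endomorphism `α` acts as the identity, so only the value `1` of the
    -- polynomial at `X = 1` matters.
    have h1 : k₂ * (X * k₂) = 1 + (k₂ ^ 2 + q * (k₂ + 1)) * (X - 1) := by
      simp only [k₂]
      ring
    rw [LinearMap.comp_apply, LinearMap.comp_apply, h1, map_add, map_mul, map_sub, aeval_X,
      map_one, LinearMap.add_apply, Module.End.mul_apply, LinearMap.sub_apply, Module.End.one_apply,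
      hv, sub_self, map_zero, add_zero, hJK]

theorem idempotent_sub_of_le {S : Type*} [Ring S] {b e : S} (hb : b * b = b) (he : e * e = e)
    (hbe : b * e = e) (heb : e * b = e) :
    (b - e) * b = b - e ∧ (b - e) * (b - e) = b - e := by
  constructor
  · rw [sub_mul, hb, heb]
  · rw [sub_mul, mul_sub, mul_sub, hb, hbe, heb, he, sub_self, sub_zero]

/-- Locally for the Nisnevich topology, an endomorphism of a projective module which is idempotent
up to a finitely generated submodule is, up to a finitely generated submodule, an idempotent. -/
theorem exists_idempotent_of_almost_idempotent [Module.Projective R P] {a : Module.End R P}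
    {C : Submodule R P} (hC : C.FG) (ha : ∀ x, a x - a (a x) ∈ C) :
    ∃ (A : Type u) (_ : CommRing A) (_ : Algebra R A), IsStratifiedEtale R A ∧
      ∃ b : Module.End A (A ⊗[R] P), b * b = b ∧ b * a.baseChange A = b ∧
        (∀ c ∈ C, b (1 ⊗ₜ c) = 0) ∧
        ∃ K : Submodule A (A ⊗[R] P), K.FG ∧ ∀ x, a.baseChange A x - b x ∈ K := by
  -- `C + a C` is stable under `a` because `a² c` differs from `a c` by an element of `C`.
  let W : Submodule R P := C ⊔ C.map a
  have hW : W.FG := Submodule.FG.sup hC (hC.map a)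
  have haW : ∀ w ∈ W, a w ∈ W := by
    have : W ≤ W.comap a := by
      refine sup_le (fun x hx => Submodule.mem_sup_right ⟨x, hx, rfl⟩) ?_
      rintro _ ⟨x, hx, rfl⟩
      rw [Submodule.mem_comap, ← sub_sub_cancel (a x) (a (a x))]
      exact sub_mem (Submodule.mem_sup_right ⟨x, hx, rfl⟩) (Submodule.mem_sup_left (ha x))
    exact fun w hw => this hw
  obtain ⟨f, hf, hf0⟩ := hW.exists_monic_aeval_eq_zero haW
  obtain ⟨A, _, _, hA, hA', q, hq⟩ := exists_etale_dvd_quadPoly hf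
  let α : Module.End A (A ⊗[R] P) := a.baseChange A
  let W' := W.baseChange A
  have hW' : W'.FG := Submodule.FG.baseChange_fg A hW
  have hα : ∀ x, α x - α (α x) ∈ W' := by
    intro x
    have : (a - a * a).baseChange A x ∈ W' :=
      LinearMap.baseChange_mem_baseChange (V := ⊤)
        (fun x _ => Submodule.mem_sup_left (ha x)) (by simp)
    rwa [LinearMap.baseChange_sub, LinearMap.baseChange_mul] at this
  have hαW : ∀ w ∈ W', α w ∈ W' := fun w hw => LinearMap.baseChange_mem_baseChange haW hw
  -- This is `E(α)`. It is idempotent because `f(a)(a² - a) = 0`, and it differs from `α` by `q(α)(α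
  -- - α²)`, with values in `W'`.
  let b : Module.End A (A ⊗[R] P) := aeval α (X + (X ^ 2 - X) * q)
  have hb : b * b = b := by
    obtain ⟨g, hg⟩ := hq
    have h1 : (X + (X ^ 2 - X) * q) * (X + (X ^ 2 - X) * q) - (X + (X ^ 2 - X) * q) =
        g * (f * (X ^ 2 - X)).map (algebraMap R A) := by
      simp only [quadPoly] at hg
      simp only [Polynomial.map_mul, Polynomial.map_sub, Polynomial.map_pow, map_X]
      linear_combination (X ^ 2 - X) * hg
    have h2 : aeval a (f * (X ^ 2 - X)) = 0 := by
      ext x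
      rw [map_mul, Module.End.mul_apply]
      refine hf0 _ ?_
      have := W.neg_mem (Submodule.mem_sup_left (ha x) : _ ∈ W)
      simpa [pow_two] using this
    have h3 := congrArg (aeval α) h1
    rw [map_mul (aeval α) g, Polynomial.aeval_baseChange, h2, LinearMap.baseChange_zero, mul_zero,
      map_sub, map_mul, sub_eq_zero] at h3
    exact h3
  have hab : ∀ x, α x - b x ∈ W' := by
    intro x
    have : α x - b x = aeval α q (α x - α (α x)) := by
      simp only [b, mul_comm _ q]
      simp [pow_two]
    rw [this]
    exact Polynomial.aeval_mem_of_mapsTo hαW q (hα x)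
  -- The idempotent `e ≤ b` has finitely generated image and fixes `b W'`, so `b - e` kills `W'`. As
  -- `α - b` lands in `W'`, this also gives `(b - e) α = b - e`.
  obtain ⟨A₂, _, _, hA₂, e, hee, hbe, heb, ⟨K, hK, heK⟩, heF⟩ :=
    exists_finite_idempotent hb (hW'.map b) (by
      rintro _ ⟨x, -, rfl⟩
      exact LinearMap.congr_fun hb x)
  let _ : Algebra R A₂ := ((algebraMap A A₂).comp (algebraMap R A)).toAlgebra
  have : IsScalarTower R A A₂ := IsScalarTower.of_algebraMap_eq' rfl
  let ε := TensorProduct.AlgebraTensorModule.cancelBaseChange R A A₂ A₂ P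
  have hε : ∀ x, ε (α.baseChange A₂ x) = a.baseChange A₂ (ε x) := by
    intro x
    suffices ε.toLinearMap ∘ₗ α.baseChange A₂ = a.baseChange A₂ ∘ₗ ε.toLinearMap from
      LinearMap.congr_fun this x
    ext x
    simp [ε, α]
  let b₁ : Module.End A₂ (A₂ ⊗[A] (A ⊗[R] P)) := b.baseChange A₂
  have hb₁ : b₁ * b₁ = b₁ := by rw [← LinearMap.baseChange_mul, hb]
  obtain ⟨hb₂, hb₂'⟩ := idempotent_sub_of_le (b := b₁) (e := e) hb₁ hee hbe heb
  have hkill : ∀ x ∈ W'.baseChange A₂, (b₁ - e) x = 0 := by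
    intro x hx
    rw [Submodule.baseChange_eq_span] at hx
    induction hx using Submodule.span_induction with
    | mem x hx =>
      obtain ⟨w, hw, rfl⟩ := hx
      rw [← hb₂, Module.End.mul_apply]
      change (b₁ - e) (b.baseChange A₂ (1 ⊗ₜ w)) = 0
      rw [LinearMap.baseChange_tmul, LinearMap.sub_apply, heF _ ⟨w, hw, rfl⟩, sub_eq_zero]
      change b.baseChange A₂ (1 ⊗ₜ b w) = _
      rw [LinearMap.baseChange_tmul]
      exact congrArg _ (LinearMap.congr_fun hb w)
    | zero => simp
    | add x y _ _ hx hy => rw [map_add, hx, hy, add_zero]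
    | smul c x _ hx => rw [map_smul, hx, smul_zero]
  have hab₂ : ∀ x, α.baseChange A₂ x - b₁ x ∈ W'.baseChange A₂ := by
    intro x
    have : (α - b).baseChange A₂ x ∈ W'.baseChange A₂ :=
      LinearMap.baseChange_mem_baseChange (V := ⊤) (fun x _ => hab x) (by simp)
    rwa [LinearMap.baseChange_sub] at this
  refine ⟨A₂, _, _, IsStratifiedEtale.trans ⟨hA, hA'⟩ hA₂, ε.conj (b₁ - e), ?_, ?_, ?_,
    (W'.baseChange A₂ ⊔ K).map ε.toLinearMap, ?_, ?_⟩
  · change ε.conj (b₁ - e) ∘ₗ ε.conj (b₁ - e) = _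
    rw [← LinearEquiv.conj_comp]
    exact congrArg ε.conj hb₂'
  · ext x
    obtain ⟨y, hy⟩ := ε.surjective (1 ⊗ₜ x)
    simp only [TensorProduct.AlgebraTensorModule.curry_apply, TensorProduct.curry_apply,
      LinearMap.coe_restrictScalars]
    rw [Module.End.mul_apply, ← hy, ← hε, LinearEquiv.conj_apply_apply,
      LinearEquiv.conj_apply_apply, ε.symm_apply_apply, ε.symm_apply_apply]
    have := hkill _ (hab₂ y)
    rw [map_sub, sub_eq_zero] at this
    rw [this]
    exact congrArg ε (LinearMap.congr_fun hb₂ y)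
  · intro c hc
    rw [LinearEquiv.conj_apply_apply]
    have : ε.symm (1 ⊗ₜ c) = 1 ⊗ₜ (1 ⊗ₜ c) := by simp [ε]
    rw [this, hkill _ (Submodule.tmul_mem_baseChange_of_mem 1
      (Submodule.tmul_mem_baseChange_of_mem 1 (Submodule.mem_sup_left hc))), map_zero]
  · exact Submodule.FG.map _ (Submodule.FG.sup (Submodule.FG.baseChange_fg A₂ hW') hK)
  · intro x
    obtain ⟨y, rfl⟩ := ε.surjective x
    rw [← hε, LinearEquiv.conj_apply_apply, ε.symm_apply_apply, ← map_sub]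
    refine ⟨_, ?_, rfl⟩
    rw [LinearMap.sub_apply, ← sub_add]
    exact add_mem (Submodule.mem_sup_left (hab₂ y)) (Submodule.mem_sup_right (heK y))

end AlmostIdempotent

/-! ### Topologies induced from products of discrete groups. -/

section InducedTopology

open Topology

theorem exists_finset_of_mem_nhds_induced {X ι : Type*} {D : ι → Type*} (f : X → ∀ i, D i)
    (x₀ : X) {W : Set X}
    (hW : W ∈ @nhds X (TopologicalSpace.induced f (@Pi.topologicalSpace ι D fun _ => ⊥)) x₀) :
    ∃ F : Finset ι, ∀ x, (∀ i ∈ F, f x i = f x₀ i) → x ∈ W := by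
  let _ : ∀ i, TopologicalSpace (D i) := fun _ => ⊥
  rw [nhds_induced, Filter.mem_comap] at hW
  obtain ⟨V, hV, hVW⟩ := hW
  rw [nhds_pi, Filter.mem_pi] at hV
  obtain ⟨I, hI, t, ht, htV⟩ := hV
  refine ⟨hI.toFinset, fun x hx => hVW (htV fun i hi => ?_)⟩
  rw [hx i (hI.mem_toFinset.mpr hi)]
  exact mem_of_mem_nhds (ht i)

theorem isOpen_induced_preimage {X ι : Type*} {D : ι → Type*} (f : X → ∀ i, D i) (i : ι)
    (T : Set (D i)) :
    IsOpen[TopologicalSpace.induced f (@Pi.topologicalSpace ι D fun _ => ⊥)] {x | f x i ∈ T} := by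
  let _ : ∀ i, TopologicalSpace (D i) := fun _ => ⊥
  refine ⟨{y | y i ∈ T}, ?_, rfl⟩
  have : DiscreteTopology (D i) := ⟨rfl⟩
  exact (isOpen_discrete T).preimage (continuous_apply i)

theorem isTopologicalAddGroup_induced_pi {X ι : Type*} [AddCommGroup X] {D : ι → Type*}
    [∀ i, AddCommGroup (D i)] (f : X →+ ∀ i, D i) :
    @IsTopologicalAddGroup X
      (TopologicalSpace.induced f (@Pi.topologicalSpace ι D fun _ => ⊥)) _ := by
  let _ : ∀ i, TopologicalSpace (D i) := fun _ => ⊥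
  have : ∀ i, DiscreteTopology (D i) := fun _ => ⟨rfl⟩
  have : ∀ i, IsTopologicalAddGroup (D i) := fun i =>
    { continuous_add := continuous_of_discreteTopology
      continuous_neg := continuous_of_discreteTopology }
  exact topologicalAddGroup_induced f

instance (R : Type u) (Q : Type v) [CommRing R] [AddCommGroup Q] [Module R Q] :
    IsTopologicalAddGroup (DiscreteDual R Q) :=
  isTopologicalAddGroup_induced_pi (X := Q →ₗ[R] R) (D := fun _ : Q => R)
    { toFun := fun f q => f q, map_zero' := rfl, map_add' := fun _ _ => rfl }

instance (R A : Type u) (M : Type v) [CommRing R] [CommRing A] [Algebra R A] [AddCommGroup M]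
    [Module R M] [TopologicalSpace M] : IsTopologicalAddGroup (CompletedTensor R A M) :=
  isTopologicalAddGroup_induced_pi (X := completedTensorSubmodule R A M)
    { toFun := fun x U => x.1 U, map_zero' := rfl, map_add' := fun _ _ => rfl }

end InducedTopology

/-! ### Tate modules as retracts of `P ⊕ R^S`, and retracts of `R^S` as duals. -/

section TateRetract

/-- The linear form underlying an element of the dual. -/
def DiscreteDual.toLinearMap {R : Type u} {Q : Type v} [CommRing R] [AddCommGroup Q] [Module R Q]
    (φ : DiscreteDual R Q) : Q →ₗ[R] R := φ

open Topology

/-- A presentation of the topological module `M` as a retract of `P ⊕ R ^ S`, where `P` and `R` are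
discrete and `R ^ S` has the product topology. -/
structure TateRetract (R : Type*) (M : Type*) (P : Type*) (S : Type*) [CommRing R]
    [AddCommGroup M] [Module R M] [TopologicalSpace M] [AddCommGroup P] [Module R P] where
  α : M →ₗ[R] P
  β : M →ₗ[R] (S → R)
  γ : P →ₗ[R] M
  δ : (S → R) →ₗ[R] M
  isOpen_ker : IsOpen (LinearMap.ker α : Set M)
  isOpen_ker_coord : ∀ s, IsOpen (LinearMap.ker (LinearMap.proj s ∘ₗ β) : Set M)
  exists_finset : ∀ W ∈ 𝓝 (0 : M), ∃ F : Finset S, ∀ f : S → R, (∀ s ∈ F, f s = 0) → δ f ∈ W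
  retract : ∀ x, γ (α x) + δ (β x) = x

theorem IsTate.exists_tateRetract {R : Type u} {M : Type v} [CommRing R] [AddCommGroup M]
    [Module R M] [TopologicalSpace M] (hM : IsTate R M) :
    ∃ (P : Type (max u v)) (_ : AddCommGroup P) (_ : Module R P) (S : Type (max u v)),
      Module.Projective R P ∧ Nonempty (TateRetract R M P S) := by
  classical
  obtain ⟨N, _, _, _, _, _, P, _, _, _, _, hP, Q, _, _, hQ, ⟨e⟩⟩ := hM
  -- Transposing a section `σ` of the free cover of `Q` exhibits the dual of `Q` as a retract of
  -- `R^Q`.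
  obtain ⟨σ, hσ⟩ := Module.projective_def'.mp hQ
  let toDual : (Q → R) →ₗ[R] DiscreteDual R Q :=
    { toFun := fun f => (Finsupp.linearCombination R f ∘ₗ σ : Q →ₗ[R] R)
      map_add' := fun f g => LinearMap.ext fun q => by
        change Finsupp.linearCombination R (f + g) (σ q) =
          Finsupp.linearCombination R f (σ q) + Finsupp.linearCombination R g (σ q)
        simp [Finsupp.linearCombination_apply, Finsupp.sum, mul_add, Finset.sum_add_distrib]
      map_smul' := fun c f => LinearMap.ext fun q => by
        change Finsupp.linearCombination R (c • f) (σ q) =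
          c • Finsupp.linearCombination R f (σ q)
        simp [Finsupp.linearCombination_apply, Finsupp.sum, Finset.mul_sum, mul_left_comm] }
  let ev : DiscreteDual R Q →ₗ[R] (Q → R) :=
    { toFun := fun φ q => φ.toLinearMap q
      map_add' := fun _ _ => rfl
      map_smul' := fun _ _ => rfl }
  have hev : ∀ φ, toDual (ev φ) = φ := by
    intro φ
    refine LinearMap.ext fun q => ?_
    let φ' : Q →ₗ[R] R := φ.toLinearMap
    change Finsupp.linearCombination R φ' (σ q) = φ' q
    conv_rhs => rw [← LinearMap.id_apply (R := R) q, ← hσ]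
    simp [Finsupp.linearCombination_apply, Finsupp.sum, map_sum]
  let f : M →ₗ[R] P × DiscreteDual R Q := e.toLinearMap ∘ₗ LinearMap.inl R M N
  let g : P × DiscreteDual R Q →ₗ[R] M := LinearMap.fst R M N ∘ₗ e.symm.toLinearMap
  have hf : Continuous f := e.continuous.comp (by fun_prop : Continuous fun x : M => (x, (0 : N)))
  have hg : Continuous g := continuous_fst.comp e.symm.continuous
  refine ⟨P, _, _, Q, hP, ⟨{
    α := LinearMap.fst R P _ ∘ₗ f
    β := ev ∘ₗ LinearMap.snd R P _ ∘ₗ f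
    γ := g ∘ₗ LinearMap.inl R P _
    δ := g ∘ₗ LinearMap.inr R P _ ∘ₗ toDual
    isOpen_ker := (isOpen_discrete {(0 : P)}).preimage (continuous_fst.comp hf)
    isOpen_ker_coord := fun q => IsOpen.preimage (continuous_snd.comp hf)
      (isOpen_induced_preimage (fun (φ : Q →ₗ[R] R) (q : Q) => φ q) q {0})
    exists_finset := fun W hW => ?_
    retract := fun x => ?_ }⟩⟩
  · have h1 : Continuous fun φ : DiscreteDual R Q => g (0, φ) := hg.comp (by fun_prop)
    have h2 : (fun φ : DiscreteDual R Q => g (0, φ)) ⁻¹' W ∈ 𝓝 (0 : DiscreteDual R Q) := by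
      refine h1.continuousAt.preimage_mem_nhds ?_
      have : g (0, 0) = 0 := map_zero g
      rwa [this]
    obtain ⟨F, hF⟩ := exists_finset_of_mem_nhds_induced
      (fun (φ : Q →ₗ[R] R) (q : Q) => φ q) 0 h2
    refine ⟨F.biUnion fun q => (σ q).support, fun φ hφ => hF _ fun q hq => ?_⟩
    change Finsupp.linearCombination R φ (σ q) = 0
    rw [Finsupp.linearCombination_apply]
    refine Finset.sum_eq_zero fun s hs => ?_
    change σ q s • φ s = 0
    rw [hφ s (Finset.mem_biUnion.mpr ⟨q, hq, hs⟩), smul_zero]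
  · change g ((f x).1, 0) + g (0, toDual (ev (f x).2)) = x
    rw [hev, ← map_add]
    have : ((f x).1, (0 : DiscreteDual R Q)) + (0, (f x).2) = f x := by ext <;> simp
    rw [this]
    change (e.symm (e (x, 0))).1 = x
    rw [e.symm_apply_apply]

theorem LinearMap.continuous_of_isOpen_ker {R M N : Type*} [CommRing R] [AddCommGroup M]
    [Module R M] [TopologicalSpace M] [IsTopologicalAddGroup M] [AddCommGroup N] [Module R N]
    [TopologicalSpace N] [DiscreteTopology N] (g : M →ₗ[R] N)
    (hg : IsOpen (LinearMap.ker g : Set M)) : Continuous g := by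
  have : IsTopologicalAddGroup N :=
    { continuous_add := continuous_of_discreteTopology
      continuous_neg := continuous_of_discreteTopology }
  refine continuous_of_continuousAt_zero g.toAddMonoidHom fun W hW => ?_
  refine Filter.mem_map.mpr (Filter.mem_of_superset (hg.mem_nhds (zero_mem _)) fun x hx => ?_)
  have h0 : g x = g 0 := by rw [map_zero]; exact hx
  change g x ∈ W
  rw [h0]
  exact mem_of_mem_nhds hW

/-- A retract of `R ^ S` is the dual of a projective module. -/
theorem exists_continuousLinearEquiv_discreteDual {R : Type u} {M : Type v} {S : Type w}
    [CommRing R] [AddCommGroup M] [Module R M] [TopologicalSpace M] [IsTopologicalAddGroup M]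
    (i : M →ₗ[R] (S → R)) (p : (S → R) →ₗ[R] M)
    (hi : ∀ s, IsOpen (LinearMap.ker (LinearMap.proj s ∘ₗ i) : Set M))
    (hp : ∀ W ∈ 𝓝 (0 : M), ∃ F : Finset S, ∀ f : S → R, (∀ s ∈ F, f s = 0) → p f ∈ W)
    (hpi : ∀ x, p (i x) = x) :
    ∃ (Q : Type (max u w)) (_ : AddCommGroup Q) (_ : Module R Q), Module.Projective R Q ∧
      Nonempty (M ≃L[R] DiscreteDual R Q) := by
  classical
  have hF : ∀ s, ∃ F : Finset S, ∀ f : S → R, (∀ t ∈ F, f t = 0) → i (p f) s = 0 :=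
    fun s => hp _ ((hi s).mem_nhds (zero_mem (LinearMap.ker (LinearMap.proj s ∘ₗ i))))
  choose F hF using hF
  -- By continuity each coordinate of the idempotent `i p` of `R^S` depends on finitely many
  -- coordinates, so `i p` is the transpose of an endomorphism `θ` of the free module on `S`. Then
  -- `θ` is idempotent, and `M` is the dual of its range.
  let θ : (S →₀ R) →ₗ[R] (S →₀ R) := Finsupp.linearCombination R fun s =>
    ∑ t ∈ F s, Finsupp.single t (i (p (Pi.single t 1)) s)
  have hθ : ∀ (f : S → R) (q : S →₀ R),
      Finsupp.linearCombination R f (θ q) = Finsupp.linearCombination R (i (p f)) q := by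
    intro f q
    suffices Finsupp.linearCombination R f ∘ₗ θ = Finsupp.linearCombination R (i (p f)) from
      LinearMap.congr_fun this q
    ext s
    have h1 := hF s (f - ∑ t ∈ F s, f t • Pi.single t 1) (by
      intro t ht
      simp [Finset.sum_apply, Pi.single_apply, ht])
    rw [map_sub, map_sub, Pi.sub_apply, sub_eq_zero] at h1
    simp [θ, h1, mul_comm]
  have hsep : ∀ q q' : S →₀ R, (∀ f : S → R, Finsupp.linearCombination R f q =
      Finsupp.linearCombination R f q') → q = q' := by
    intro q q' h
    ext s
    have := h (Pi.single s 1)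
    simp only [Finsupp.linearCombination_apply, Finsupp.sum, Pi.single_apply, smul_eq_mul, mul_ite,
      mul_one, mul_zero, Finset.sum_ite_eq', Finsupp.mem_support_iff] at this
    split_ifs at this <;> simp_all
  have hθθ : ∀ q, θ (θ q) = θ q := fun q => hsep _ _ fun f => by
    rw [hθ, hθ, hθ, hpi]
  have hidem : ∀ q : LinearMap.range θ, θ q = q := by
    rintro ⟨_, q, rfl⟩
    exact hθθ q
  let toFun : M →ₗ[R] DiscreteDual R (LinearMap.range θ) :=
    { toFun := fun x =>
        (Finsupp.linearCombination R (i x) ∘ₗ (LinearMap.range θ).subtype : _ →ₗ[R] R)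
      map_add' := fun x y => LinearMap.ext fun q => by
        change Finsupp.linearCombination R (i (x + y)) (q : S →₀ R) =
          Finsupp.linearCombination R (i x) (q : S →₀ R) +
            Finsupp.linearCombination R (i y) (q : S →₀ R)
        simp [Finsupp.linearCombination_apply, Finsupp.sum, mul_add, Finset.sum_add_distrib]
      map_smul' := fun c x => LinearMap.ext fun q => by
        change Finsupp.linearCombination R (i (c • x)) (q : S →₀ R) =
          c • Finsupp.linearCombination R (i x) (q : S →₀ R)
        simp [Finsupp.linearCombination_apply, Finsupp.sum, Finset.mul_sum, mul_left_comm] }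
  let coords (φ : DiscreteDual R (LinearMap.range θ)) (s : S) : R :=
    φ.toLinearMap (θ.rangeRestrict (Finsupp.single s 1))
  have hcoords : ∀ φ : DiscreteDual R (LinearMap.range θ),
      Finsupp.linearCombination R (coords φ) = φ.toLinearMap ∘ₗ θ.rangeRestrict := by
    intro φ
    ext s
    simp [coords]
  let invFun : DiscreteDual R (LinearMap.range θ) →ₗ[R] M :=
    { toFun := fun φ => p (coords φ)
      map_add' := fun φ ψ => by rw [← map_add]; rfl
      map_smul' := fun c φ => by rw [RingHom.id_apply, ← map_smul]; rfl }
  have h₁ : toFun ∘ₗ invFun = LinearMap.id := by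
    refine LinearMap.ext fun φ => LinearMap.ext fun q => ?_
    change Finsupp.linearCombination R (i (p (coords φ))) (q : S →₀ R) = φ.toLinearMap q
    rw [← hθ, hidem, hcoords]
    change φ.toLinearMap (θ.rangeRestrict (q : S →₀ R)) = φ.toLinearMap q
    congr 1
    exact Subtype.ext (hidem q)
  have h₂ : invFun ∘ₗ toFun = LinearMap.id := by
    refine LinearMap.ext fun x => ?_
    change p (coords (Finsupp.linearCombination R (i x) ∘ₗ (LinearMap.range θ).subtype)) = x
    have : coords (Finsupp.linearCombination R (i x) ∘ₗ (LinearMap.range θ).subtype) = i x := by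
      funext s
      change Finsupp.linearCombination R (i x) (θ (Finsupp.single s 1)) = i x s
      rw [hθ, hpi]
      simp
    rw [this, hpi]
  let e : M ≃ₗ[R] DiscreteDual R (LinearMap.range θ) :=
    LinearEquiv.ofLinearMap toFun invFun h₁ h₂
  suffices hc : Continuous toFun ∧ Continuous invFun from
    ⟨LinearMap.range θ, inferInstance, inferInstance,
      Module.Projective.of_split (LinearMap.range θ).subtype θ.rangeRestrict
        (LinearMap.ext fun q => Subtype.ext (hidem q)),
      ⟨⟨e, hc.1, hc.2⟩⟩⟩
  constructor
  · rw [continuous_induced_rng]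
    refine @continuous_pi _ _ _ _ (fun _ => ⊥) _ fun q => ?_
    let _ : TopologicalSpace R := ⊥
    have : DiscreteTopology R := ⟨rfl⟩
    let l : M →ₗ[R] R :=
      { toFun := fun x => Finsupp.linearCombination R (i x) (q : S →₀ R)
        map_add' := fun x y => LinearMap.congr_fun (toFun.map_add x y) q
        map_smul' := fun c x => LinearMap.congr_fun (toFun.map_smul c x) q }
    change Continuous l
    refine LinearMap.continuous_of_isOpen_ker l ?_
    refine AddSubgroup.isOpen_of_mem_nhds (LinearMap.ker l).toAddSubgroup (g := 0) ?_
    have hO : (⋂ s ∈ (q : S →₀ R).support,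
        (LinearMap.ker (LinearMap.proj s ∘ₗ i) : Set M)) ∈ 𝓝 (0 : M) :=
      (isOpen_biInter_finset fun s _ => hi s).mem_nhds (by simp)
    refine Filter.mem_of_superset hO fun x hx => ?_
    simp only [Set.mem_iInter] at hx
    change Finsupp.linearCombination R (i x) (q : S →₀ R) = 0
    rw [Finsupp.linearCombination_apply]
    refine Finset.sum_eq_zero fun s hs => ?_
    have : i x s = 0 := hx s hs
    change (q : S →₀ R) s • i x s = 0
    rw [this, smul_zero]
  · refine continuous_of_continuousAt_zero invFun.toAddMonoidHom ?_
    intro W hW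
    have hW' : W ∈ 𝓝 (0 : M) := by
      have h0 : invFun 0 = 0 := map_zero invFun
      rw [← h0]
      exact hW
    obtain ⟨G, hG⟩ := hp W hW'
    have hO : (⋂ s ∈ G, {φ : LinearMap.range θ →ₗ[R] R |
        φ (θ.rangeRestrict (Finsupp.single s 1)) ∈ ({0} : Set R)}) ∈
          𝓝 (0 : DiscreteDual R (LinearMap.range θ)) := by
      refine IsOpen.mem_nhds (isOpen_biInter_finset fun s _ =>
        isOpen_induced_preimage (fun (φ : LinearMap.range θ →ₗ[R] R) q => φ q)
          (θ.rangeRestrict (Finsupp.single s 1)) {0}) ?_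
      exact Set.mem_iInter₂.mpr fun s _ => rfl
    refine Filter.mem_map.mpr (Filter.mem_of_superset hO fun φ hφ => ?_)
    exact hG _ fun s hs => Set.mem_iInter₂.mp hφ s hs

end TateRetract

/-! ### Completed base change of a presentation as a retract. -/

section BaseChange

open Topology

namespace CompletedTensor

variable {R : Type u} (A : Type u) {M : Type v} [CommRing R] [CommRing A] [Algebra R A]
  [AddCommGroup M] [Module R M] [TopologicalSpace M]

/-- The projection of the completed tensor product to `A ⊗ (M / U)`. -/
def proj (U : OpenSubmodule R M) : CompletedTensor R A M →ₗ[A] A ⊗[R] (M ⧸ U.1) where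
  toFun x := x.1 U
  map_add' _ _ := rfl
  map_smul' _ _ := rfl

variable {A}

theorem ext_proj {x y : CompletedTensor R A M} (h : ∀ U, proj A U x = proj A U y) : x = y :=
  Subtype.ext (funext h)

theorem factor_proj (x : CompletedTensor R A M) {U V : OpenSubmodule R M} (h : U.1 ≤ V.1) :
    (Submodule.factor h).baseChange A (proj A U x) = proj A V x :=
  x.2 U V h

theorem isOpen_ker_comp_proj {N : Type*} [AddCommGroup N] [Module A N] (U : OpenSubmodule R M)
    (g : A ⊗[R] (M ⧸ U.1) →ₗ[A] N) :
    IsOpen (LinearMap.ker (g ∘ₗ proj A U) : Set (CompletedTensor R A M)) :=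
  isOpen_induced_preimage (D := fun U : OpenSubmodule R M => A ⊗[R] (M ⧸ U.1))
    (fun (x : completedTensorSubmodule R A M) (U : OpenSubmodule R M) => x.1 U) U
    (LinearMap.ker g : Set (A ⊗[R] (M ⧸ U.1)))

theorem exists_finset_of_mem_nhds_zero {W : Set (CompletedTensor R A M)} (hW : W ∈ 𝓝 0) :
    ∃ F : Finset (OpenSubmodule R M), ∀ x, (∀ U ∈ F, proj A U x = 0) → x ∈ W :=
  exists_finset_of_mem_nhds_induced (D := fun U : OpenSubmodule R M => A ⊗[R] (M ⧸ U.1))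
    (fun (x : completedTensorSubmodule R A M) (U : OpenSubmodule R M) => x.1 U) 0 hW

variable (A M) in
/-- The canonical map from the tensor product to its completion. -/
def of : A ⊗[R] M →ₗ[A] CompletedTensor R A M where
  toFun z := ⟨fun U => U.1.mkQ.baseChange A z, fun U V h => by
    rw [← LinearMap.comp_apply, ← LinearMap.baseChange_comp]
    rfl⟩
  map_add' x y := Subtype.ext (funext fun U => map_add _ x y)
  map_smul' a x := Subtype.ext (funext fun U => map_smul _ a x)

theorem proj_of (U : OpenSubmodule R M) (z : A ⊗[R] M) :
    proj A U (of A M z) = U.1.mkQ.baseChange A z := rfl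

variable (A) in
/-- The continuous extension of a linear map with open kernel. -/
def lift {N : Type*} [AddCommGroup N] [Module R N] (g : M →ₗ[R] N)
    (hg : IsOpen (LinearMap.ker g : Set M)) : CompletedTensor R A M →ₗ[A] A ⊗[R] N :=
  ((LinearMap.ker g).liftQ g le_rfl).baseChange A ∘ₗ proj A ⟨LinearMap.ker g, hg⟩

/-- Compatibility of the components lets the extension be computed at any small enough `U`, so
finitely many extensions can be compared at a common open submodule. -/
theorem lift_eq {N : Type*} [AddCommGroup N] [Module R N] (g : M →ₗ[R] N)
    (hg : IsOpen (LinearMap.ker g : Set M)) (U : OpenSubmodule R M) (h : U.1 ≤ LinearMap.ker g)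
    (x : CompletedTensor R A M) :
    lift A g hg x = (U.1.liftQ g h).baseChange A (proj A U x) := by
  rw [lift, LinearMap.comp_apply, ← factor_proj x (V := ⟨LinearMap.ker g, hg⟩) h,
    ← LinearMap.comp_apply, ← LinearMap.baseChange_comp]
  congr 2
  ext
  rfl

theorem lift_of {N : Type*} [AddCommGroup N] [Module R N] (g : M →ₗ[R] N)
    (hg : IsOpen (LinearMap.ker g : Set M)) (z : A ⊗[R] M) :
    lift A g hg (of A M z) = g.baseChange A z := by
  change ((LinearMap.ker g).liftQ g le_rfl).baseChange A ((LinearMap.ker g).mkQ.baseChange A z) = _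
  rw [← LinearMap.comp_apply, ← LinearMap.baseChange_comp, Submodule.liftQ_mkQ]

theorem isOpen_ker_lift {N : Type*} [AddCommGroup N] [Module R N] (g : M →ₗ[R] N)
    (hg : IsOpen (LinearMap.ker g : Set M)) :
    IsOpen (LinearMap.ker (lift A g hg) : Set (CompletedTensor R A M)) :=
  isOpen_ker_comp_proj ⟨LinearMap.ker g, hg⟩ _

theorem lift_mem_of_mem_ofSubmodule {N : Type*} [AddCommGroup N] [Module R N] (g : M →ₗ[R] N)
    (hg : IsOpen (LinearMap.ker g : Set M)) {L : Submodule R M} {x : CompletedTensor R A M}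
    (hx : x ∈ ofSubmodule A L) : lift A g hg x ∈ (L.map g).baseChange A := by
  obtain ⟨y, rfl⟩ := hx
  let U : OpenSubmodule R M := ⟨LinearMap.ker g, hg⟩
  change ((LinearMap.ker g).liftQ g le_rfl).baseChange A
    (mapComponent A L.subtypeL U (y.1 (comapOpen L.subtypeL U))) ∈ _
  rw [mapComponent, ← LinearMap.comp_apply, ← LinearMap.baseChange_comp]
  refine LinearMap.baseChange_mem_baseChange (V := ⊤) (fun z _ => ?_) (by simp)
  obtain ⟨l, rfl⟩ := Submodule.mkQ_surjective _ z
  exact ⟨l, l.2, rfl⟩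

end CompletedTensor

namespace TateRetract

open CompletedTensor

variable {R : Type u} {M : Type v} {P S : Type w} [CommRing R] [AddCommGroup M] [Module R M]
  [TopologicalSpace M] [AddCommGroup P] [Module R P] (T : TateRetract R M P S)

-- Modulo `U` the map `δ` sees only finitely many coordinates, which makes its base change a finite
-- sum in each component of the completion.
open Classical in
theorem exists_finset_sum_mem (U : OpenSubmodule R M) :
    ∃ F : Finset S, ∀ f : S → R, T.δ f - ∑ s ∈ F, f s • T.δ (Pi.single s 1) ∈ U.1 := by
  obtain ⟨F, hF⟩ := T.exists_finset U.1 (U.2.mem_nhds (zero_mem _))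
  refine ⟨F, fun f => ?_⟩
  have := hF (f - ∑ s ∈ F, f s • Pi.single s 1) (by
    intro t ht
    simp [Finset.sum_apply, Pi.single_apply, ht])
  simpa using this

/-- A finite set of indices outside of which the coordinates do not contribute modulo `U`. -/
noncomputable def coordSupport (U : OpenSubmodule R M) : Finset S :=
  (T.exists_finset_sum_mem U).choose

open Classical in
theorem sub_sum_mem (U : OpenSubmodule R M) (f : S → R) :
    T.δ f - ∑ s ∈ T.coordSupport U, f s • T.δ (Pi.single s 1) ∈ U.1 :=
  (T.exists_finset_sum_mem U).choose_spec f

open Classical in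
theorem single_mem_of_notMem (U : OpenSubmodule R M) {s : S} (hs : s ∉ T.coordSupport U) :
    T.δ (Pi.single s 1) ∈ U.1 := by
  have := T.sub_sum_mem U (Pi.single s 1)
  rwa [Finset.sum_eq_zero, sub_zero] at this
  intro t ht
  rw [Pi.single_eq_of_ne (by rintro rfl; exact hs ht), zero_smul]

variable (A : Type u) [CommRing A] [Algebra R A]

open Classical in
/-- The component at `U` of the base change of the map `δ`. -/
noncomputable def baseChangeδ (U : OpenSubmodule R M) : (S → A) →ₗ[A] A ⊗[R] (M ⧸ U.1) :=
  ∑ s ∈ T.coordSupport U,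
    (LinearMap.toSpanSingleton A _ (1 ⊗ₜ[R] U.1.mkQ (T.δ (Pi.single s 1)))) ∘ₗ LinearMap.proj s

variable {A}

open Classical in
theorem baseChangeδ_apply (U : OpenSubmodule R M) (f : S → A) : T.baseChangeδ A U f =
    ∑ s ∈ T.coordSupport U, f s • (1 ⊗ₜ[R] U.1.mkQ (T.δ (Pi.single s 1))) := by
  simp [baseChangeδ]

-- The chosen finite support is immaterial: extra indices contribute zero modulo `U`. This gives
-- compatibility between different open submodules.
open Classical in
theorem baseChangeδ_eq (U : OpenSubmodule R M) (F : Finset S)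
    (hF : ∀ s ∉ F, T.δ (Pi.single s 1) ∈ U.1) (f : S → A) :
    T.baseChangeδ A U f = ∑ s ∈ F, f s • (1 ⊗ₜ[R] U.1.mkQ (T.δ (Pi.single s 1))) := by
  have h0 : ∀ s, T.δ (Pi.single s 1) ∈ U.1 →
      f s • (1 ⊗ₜ[R] U.1.mkQ (T.δ (Pi.single s 1)) : A ⊗[R] (M ⧸ U.1)) = 0 := by
    intro s hs
    rw [Submodule.mkQ_apply, (Submodule.Quotient.mk_eq_zero _).mpr hs, TensorProduct.tmul_zero,
      smul_zero]
  rw [baseChangeδ_apply,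
    Finset.sum_subset (Finset.subset_union_left (s₁ := T.coordSupport U) (s₂ := F))
      fun s _ hs => h0 s (T.single_mem_of_notMem U hs)]
  exact (Finset.sum_subset Finset.subset_union_right fun s _ hs => h0 s (hF s hs)).symm

variable (A)

theorem isOpen_inf_ker (U : OpenSubmodule R M) : IsOpen ((U.1 ⊓ LinearMap.ker T.α ⊓
    ⨅ s ∈ T.coordSupport U, LinearMap.ker (LinearMap.proj s ∘ₗ T.β) : Submodule R M) : Set M) := by
  simp only [Submodule.coe_inf, Submodule.coe_iInf]
  exact (U.2.inter T.isOpen_ker).inter (isOpen_biInter_finset fun s _ => T.isOpen_ker_coord s)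

variable {A} in
open Classical in
theorem factor_baseChangeδ {U V : OpenSubmodule R M} (h : U.1 ≤ V.1) (f : S → A) :
    (Submodule.factor h).baseChange A (T.baseChangeδ A U f) = T.baseChangeδ A V f := by
  rw [T.baseChangeδ_eq V (T.coordSupport U)
    (fun s hs => h (T.single_mem_of_notMem U hs)), T.baseChangeδ_apply, map_sum]
  refine Finset.sum_congr rfl fun s _ => ?_
  rw [map_smul, LinearMap.baseChange_tmul]
  rfl

/-- The base change of the map `δ`. -/
noncomputable def completedδ : (S → A) →ₗ[A] CompletedTensor R A M where
  toFun f := ⟨fun U => T.baseChangeδ A U f, fun _ _ h => T.factor_baseChangeδ h f⟩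
  map_add' f g := Subtype.ext (funext fun U => map_add (T.baseChangeδ A U) f g)
  map_smul' a f := Subtype.ext (funext fun U => map_smul (T.baseChangeδ A U) a f)

/-- The base change of the coordinates `β`. -/
noncomputable def completedβ : CompletedTensor R A M →ₗ[A] (S → A) :=
  LinearMap.pi fun s => (TensorProduct.AlgebraTensorModule.rid R A A).toLinearMap ∘ₗ
    lift A (LinearMap.proj s ∘ₗ T.β) (T.isOpen_ker_coord s)

variable {A}

theorem proj_completedδ (U : OpenSubmodule R M) (f : S → A) :
    proj A U (T.completedδ A f) = T.baseChangeδ A U f := rfl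

theorem completedβ_apply (x : CompletedTensor R A M) (s : S) : T.completedβ A x s =
    TensorProduct.AlgebraTensorModule.rid R A A
      (lift A (LinearMap.proj s ∘ₗ T.β) (T.isOpen_ker_coord s) x) := rfl

open Classical in
theorem completed_retract_tmul (U : OpenSubmodule R M) (a : A) (m : M) :
    a ⊗ₜ[R] U.1.mkQ (T.γ (T.α m)) + ∑ s ∈ T.coordSupport U,
      (T.β m s • a) • (1 ⊗ₜ[R] U.1.mkQ (T.δ (Pi.single s 1))) = a ⊗ₜ[R] U.1.mkQ m := by
  have h : U.1.mkQ m = U.1.mkQ (T.γ (T.α m)) +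
      ∑ s ∈ T.coordSupport U, T.β m s • U.1.mkQ (T.δ (Pi.single s 1)) := by
    have h2 : U.1.mkQ (T.δ (T.β m)) = U.1.mkQ (∑ s ∈ T.coordSupport U,
        T.β m s • T.δ (Pi.single s 1)) :=
      (Submodule.Quotient.eq U.1).mpr (T.sub_sum_mem U (T.β m))
    conv_lhs => rw [← T.retract m, map_add, h2]
    simp only [map_sum, map_smul]
  rw [h, TensorProduct.tmul_add, TensorProduct.tmul_sum]
  congr 1
  refine Finset.sum_congr rfl fun s _ => ?_
  rw [TensorProduct.smul_tmul', smul_eq_mul, mul_one, TensorProduct.smul_tmul]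

theorem completed_retract (x : CompletedTensor R A M) :
    of A M (T.γ.baseChange A (lift A T.α T.isOpen_ker x)) + T.completedδ A (T.completedβ A x) =
      x := by
  classical
  refine ext_proj fun U => ?_
  -- On this `V` the map `α` and all coordinates relevant modulo `U` vanish, so every term is a
  -- function of the single component `proj A V x`, and the identity can be checked on pure tensors.
  let V : OpenSubmodule R M := ⟨_, T.isOpen_inf_ker U⟩
  have hVU : V.1 ≤ U.1 := inf_le_left.trans inf_le_left
  have hVα : V.1 ≤ LinearMap.ker T.α := inf_le_left.trans inf_le_right
  have hVβ : ∀ s ∈ T.coordSupport U, V.1 ≤ LinearMap.ker (LinearMap.proj s ∘ₗ T.β) :=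
    fun s hs => inf_le_right.trans (iInf₂_le s hs)
  rw [map_add, proj_of, proj_completedδ, baseChangeδ_apply, lift_eq _ _ V hVα,
    ← factor_proj x hVU, ← Finset.sum_attach]
  have h1 : ∀ s ∈ (T.coordSupport U).attach, T.completedβ A x s.1 =
      TensorProduct.AlgebraTensorModule.rid R A A
        ((V.1.liftQ (LinearMap.proj s.1 ∘ₗ T.β) (hVβ s.1 s.2)).baseChange A (proj A V x)) :=
    fun s _ => by rw [completedβ_apply, lift_eq _ _ V (hVβ s.1 s.2) x]
  rw [Finset.sum_congr rfl fun s hs => by rw [h1 s hs]]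
  generalize proj A V x = z
  induction z using TensorProduct.induction_on with
  | zero => simp
  | add y z hy hz =>
    simp only [map_add, add_smul, Finset.sum_add_distrib]
    rw [← hy, ← hz]
    abel
  | tmul a m =>
    obtain ⟨m, rfl⟩ := Submodule.mkQ_surjective _ m
    refine Eq.trans ?_ (T.completed_retract_tmul U a m)
    rw [← Finset.sum_attach (T.coordSupport U)]
    rfl

variable (A)

/-- The base change of a presentation as a retract of `P ⊕ R ^ S`. -/
noncomputable def baseChange : TateRetract A (CompletedTensor R A M) (A ⊗[R] P) S where
  α := lift A T.α T.isOpen_ker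
  β := T.completedβ A
  γ := of A M ∘ₗ T.γ.baseChange A
  δ := T.completedδ A
  isOpen_ker := isOpen_ker_lift _ _
  isOpen_ker_coord s := by
    rw [completedβ, LinearMap.proj_pi, LinearEquiv.ker_comp]
    exact isOpen_ker_lift _ _
  exists_finset W hW := by
    classical
    obtain ⟨G, hG⟩ := exists_finset_of_mem_nhds_zero hW
    refine ⟨G.biUnion T.coordSupport, fun f hf => hG _ fun U hU => ?_⟩
    rw [proj_completedδ, baseChangeδ_apply]
    refine Finset.sum_eq_zero fun s hs => ?_
    rw [hf s (Finset.mem_biUnion.mpr ⟨U, hU, hs⟩), zero_smul]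
  retract := T.completed_retract

theorem baseChange_α_γ (y : A ⊗[R] P) :
    (T.baseChange A).α ((T.baseChange A).γ y) = (T.α ∘ₗ T.γ).baseChange A y := by
  change lift A T.α T.isOpen_ker (of A M (T.γ.baseChange A y)) = _
  rw [lift_of, LinearMap.baseChange_comp, LinearMap.comp_apply]

theorem baseChange_α_δ_mem {C : Submodule R P} (hC : ∀ f, T.α (T.δ f) ∈ C) (f : S → A) :
    (T.baseChange A).α ((T.baseChange A).δ f) ∈ C.baseChange A := by
  classical
  let U : OpenSubmodule R M := ⟨LinearMap.ker T.α, T.isOpen_ker⟩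
  change lift A T.α T.isOpen_ker (T.completedδ A f) ∈ _
  rw [lift_eq _ _ U le_rfl, proj_completedδ, baseChangeδ_apply, map_sum]
  refine Submodule.sum_mem _ fun s _ => ?_
  rw [map_smul, LinearMap.baseChange_tmul]
  exact Submodule.smul_mem _ _ (Submodule.tmul_mem_baseChange_of_mem 1 (hC _))

end TateRetract

end BaseChange

/-! ### The coprojective lattice and the elementary decomposition. -/

section CoprojectiveLattice

open Topology

namespace TateRetract

variable {R : Type u} {M : Type v} {P S : Type w} [CommRing R] [AddCommGroup M] [Module R M]
  [TopologicalSpace M] [AddCommGroup P] [Module R P] (T : TateRetract R M P S)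

theorem exists_fg_of_isOpen {U : Submodule R M} (hU : IsOpen (U : Set M)) :
    ∃ K : Submodule R M, K.FG ∧ K ≤ LinearMap.range T.δ ∧ ∀ f, ∃ k ∈ K, T.δ f - k ∈ U := by
  classical
  refine ⟨Submodule.span R ((fun s => T.δ (Pi.single s 1)) '' T.coordSupport ⟨U, hU⟩),
    Submodule.fg_span ((T.coordSupport ⟨U, hU⟩).finite_toSet.image _), ?_, fun f =>
    ⟨_, ?_, T.sub_sum_mem ⟨U, hU⟩ f⟩⟩
  · rw [Submodule.span_le]
    rintro _ ⟨s, -, rfl⟩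
    exact ⟨_, rfl⟩
  · exact Submodule.sum_mem _ fun s hs =>
      Submodule.smul_mem _ _ (Submodule.subset_span ⟨s, hs, by congr⟩)

theorem exists_fg_α_δ_mem : ∃ C : Submodule R P, C.FG ∧ ∀ f, T.α (T.δ f) ∈ C := by
  obtain ⟨K, hK, -, hKf⟩ := T.exists_fg_of_isOpen T.isOpen_ker
  refine ⟨K.map T.α, hK.map _, fun f => ?_⟩
  obtain ⟨k, hk, h⟩ := hKf f
  rw [LinearMap.mem_ker, map_sub, sub_eq_zero] at h
  exact ⟨k, hk, h.symm⟩

theorem fg_map_α_of_isLattice {L : Submodule R M} (hL : IsLattice L) : (L.map T.α).FG := by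
  have := hL.2 (L ⊓ LinearMap.ker T.α) (hL.1.inter T.isOpen_ker) inf_le_left
  have hle : (L ⊓ LinearMap.ker T.α).submoduleOf L ≤ LinearMap.ker (T.α ∘ₗ L.subtype) := by
    intro x hx
    have hx' : (x : M) ∈ L ⊓ LinearMap.ker T.α := hx
    exact hx'.2
  have hg : LinearMap.range (Submodule.liftQ _ (T.α ∘ₗ L.subtype) hle) = L.map T.α := by
    rw [Submodule.range_liftQ, LinearMap.range_comp, Submodule.range_subtype]
  rw [← hg]
  exact Module.Finite.iff_fg.mp inferInstance

/-- Modulo an open submodule, `range T.δ` is covered by a finitely generated submodule, and `K`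
contributes finitely many more generators. -/
theorem isLattice_of_eq [IsTopologicalAddGroup M] {L : Submodule R M} {K : Submodule R M}
    (hL : LinearMap.ker T.α ≤ L) (hK : K.FG) (h : L = K ⊔ LinearMap.range T.δ) : IsLattice L := by
  refine ⟨AddSubgroup.isOpen_mono (H₁ := (LinearMap.ker T.α).toAddSubgroup)
    (H₂ := L.toAddSubgroup) hL T.isOpen_ker, fun U hU hUL => ?_⟩
  obtain ⟨N, hN, hNδ, hNf⟩ := T.exists_fg_of_isOpen hU
  have hNL : K ⊔ N ≤ L := h ▸ sup_le_sup_left hNδ K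
  have : Module.Finite R (K ⊔ N : Submodule R M) :=
    Module.Finite.iff_fg.mpr (Submodule.FG.sup hK hN)
  refine Module.Finite.of_surjective
    ((U.submoduleOf L).mkQ ∘ₗ Submodule.inclusion hNL) fun z => ?_
  obtain ⟨⟨x, hx⟩, rfl⟩ := Submodule.mkQ_surjective _ z
  obtain ⟨k, hk, _, ⟨f, rfl⟩, rfl⟩ := Submodule.mem_sup.mp (h ▸ hx)
  obtain ⟨n, hn, hnf⟩ := hNf f
  refine ⟨⟨k + n, Submodule.add_mem_sup hk hn⟩, ?_⟩
  refine (Submodule.Quotient.eq _).mpr ?_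
  change (k + n) - (k + T.δ f) ∈ U
  rw [add_sub_add_left_eq_sub, ← neg_sub]
  exact U.neg_mem hnf

variable {T} {b : Module.End R P}

/-- Apply `α` to `x = γ α x + δ β x`: the first term is in `K` because `b (α x) = 0`, the second in
`C`. -/
theorem α_mem_of_mem_ker {C K : Submodule R P} (hC : ∀ f, T.α (T.δ f) ∈ C)
    (hK : ∀ y, T.α (T.γ y) - b y ∈ K) {x : M} (hx : b (T.α x) = 0) : T.α x ∈ K ⊔ C := by
  have h1 := hK (T.α x)
  rw [hx, sub_zero] at h1
  have h2 := congrArg T.α (T.retract x)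
  rw [map_add] at h2
  rw [← h2]
  exact Submodule.add_mem_sup h1 (hC _)

/-- The quotient is `range b`, a summand of `P`, because `bαγ = b`. The kernel is `range δ` plus the
`γ`-image of a finitely generated submodule; applying `1 - b` to `K ⊔ C` keeps that image inside the
kernel. -/
theorem isCoprojectiveLattice_ker [IsTopologicalAddGroup M] [Module.Projective R P]
    (hb : b * b = b) (hbα : ∀ y, b (T.α (T.γ y)) = b y) (hbδ : ∀ f, b (T.α (T.δ f)) = 0)
    (hK : ∃ K : Submodule R P, K.FG ∧ ∀ y, T.α (T.γ y) - b y ∈ K) :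
    IsCoprojectiveLattice (LinearMap.ker (b ∘ₗ T.α)) := by
  have hbb : ∀ y, b (b y) = b y := LinearMap.congr_fun hb
  constructor
  · obtain ⟨K, hKfg, hK⟩ := hK
    obtain ⟨C, hCfg, hC⟩ := T.exists_fg_α_δ_mem
    refine T.isLattice_of_eq (K := ((K ⊔ C).map (LinearMap.id - b)).map T.γ) ?_
      (((Submodule.FG.sup hKfg hCfg).map _).map _) (le_antisymm ?_ (sup_le ?_ ?_))
    · intro x hx
      rw [LinearMap.mem_ker] at hx
      rw [LinearMap.mem_ker, LinearMap.comp_apply, hx, map_zero]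
    · intro x hx
      have hx' : b (T.α x) = 0 := hx
      rw [← T.retract x]
      refine Submodule.add_mem_sup ⟨T.α x, ⟨T.α x, α_mem_of_mem_ker hC hK hx', ?_⟩, rfl⟩ ⟨_, rfl⟩
      rw [LinearMap.sub_apply, LinearMap.id_apply, hx', sub_zero]
    · rintro _ ⟨_, ⟨y, -, rfl⟩, rfl⟩
      change b (T.α (T.γ (y - b y))) = 0
      rw [hbα, map_sub, hbb, sub_self]
    · rintro _ ⟨f, rfl⟩
      exact hbδ f
  · have hr : LinearMap.range (b ∘ₗ T.α) = LinearMap.range b := by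
      refine le_antisymm (LinearMap.range_comp_le_range _ _) ?_
      rintro _ ⟨y, rfl⟩
      exact ⟨T.γ y, hbα y⟩
    have : Module.Projective R (LinearMap.range b) :=
      Module.Projective.of_split (LinearMap.range b).subtype b.rangeRestrict (by
        ext ⟨_, y, rfl⟩
        exact hbb y)
    exact Module.Projective.of_equiv
      ((LinearEquiv.ofEq _ _ hr).symm.trans (b ∘ₗ T.α).quotKerEquivRange.symm)

end TateRetract

theorem TateRetract.isElementaryTate {R : Type u} {M : Type (max u v)} {P S : Type (max u v)}
    [CommRing R] [AddCommGroup M] [Module R M] [TopologicalSpace M] [IsTopologicalAddGroup M]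
    [AddCommGroup P] [Module R P] [Module.Projective R P] {T : TateRetract R M P S}
    {b : Module.End R P} (hb : b * b = b) (hbα : ∀ y, b (T.α (T.γ y)) = b y)
    (hbδ : ∀ f, b (T.α (T.δ f)) = 0)
    (hK : ∃ K : Submodule R P, K.FG ∧ ∀ y, T.α (T.γ y) - b y ∈ K) : IsElementaryTate R M := by
  have hbb : ∀ y, b (b y) = b y := LinearMap.congr_fun hb
  have : Module.Projective R (LinearMap.range b) :=
    Module.Projective.of_split (LinearMap.range b).subtype b.rangeRestrict (by
      ext ⟨_, y, rfl⟩
      exact hbb y)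
  obtain ⟨K, hKfg, hK⟩ := hK
  obtain ⟨C, hCfg, hC⟩ := T.exists_fg_α_δ_mem
  obtain ⟨n, k, j, hjk⟩ := exists_finite_factorization (Submodule.FG.sup hKfg hCfg)
  let L := LinearMap.ker (b ∘ₗ T.α)
  let ρ : M →ₗ[R] L := (LinearMap.id - T.γ ∘ₗ b ∘ₗ T.α).codRestrict L fun x => by
    change b (T.α (x - T.γ (b (T.α x)))) = 0
    rw [map_sub, map_sub, hbα, hbb, sub_self]
  have hρ : ∀ x, (ρ x : M) = x - T.γ (b (T.α x)) := fun x => rfl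
  have hρL : ∀ x : L, ρ x = x := fun x => Subtype.ext (by
    have hx : b (T.α x) = 0 := x.2
    rw [hρ, hx, map_zero, sub_zero])
  -- On `L` the values of `α` lie in the finitely generated `K ⊔ C`, so they are recorded by `n`
  -- coordinates. Hence `L` is a retract of `R^(S ⊔ Fin n)`, with `ρ` projecting back onto `L`.
  let i : L →ₗ[R] (S ⊕ Fin n → R) := (LinearEquiv.sumArrowLequivProdArrow S (Fin n) R R).symm ∘ₗ
    ((T.β.prod (k ∘ₗ T.α)) ∘ₗ L.subtype)
  let p : (S ⊕ Fin n → R) →ₗ[R] L := ρ ∘ₗ (T.δ.coprod (T.γ ∘ₗ j)) ∘ₗ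
    (LinearEquiv.sumArrowLequivProdArrow S (Fin n) R R).toLinearMap
  obtain ⟨Q, _, _, hQ, ⟨e⟩⟩ := exists_continuousLinearEquiv_discreteDual i p (by
      rintro (s | m)
      · exact (T.isOpen_ker_coord s).preimage continuous_subtype_val
      · refine AddSubgroup.isOpen_mono (H₁ := ((LinearMap.ker T.α).comap L.subtype).toAddSubgroup)
          (H₂ := (LinearMap.ker (LinearMap.proj (Sum.inr m) ∘ₗ i)).toAddSubgroup) ?_
          (T.isOpen_ker.preimage continuous_subtype_val)
        intro x hx
        change k (T.α x) m = 0
        have hx' : T.α x = 0 := hx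
        rw [hx', map_zero]
        rfl) (by
      classical
      intro W hW
      obtain ⟨V, hV, hVW⟩ := mem_nhds_subtype _ _ _ |>.mp hW
      obtain ⟨F, hF⟩ := T.exists_finset V hV
      -- All `n` extra coordinates are made to vanish, so only the contribution of `δ` has to be
      -- small.
      refine ⟨F.disjSum Finset.univ, fun f hf => hVW ?_⟩
      have h1 : (fun m => f (Sum.inr m)) = 0 := by
        funext m
        exact hf _ (by simp)
      change (ρ (T.δ (fun s => f (Sum.inl s)) + T.γ (j fun m => f (Sum.inr m))) : M) ∈ V
      rw [h1, map_zero, map_zero, add_zero, hρ, hbδ, map_zero, sub_zero]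
      exact hF _ fun s hs => hf _ (by simpa using hs)) (by
      intro x
      change ρ (T.δ (T.β x) + T.γ (j (k (T.α x)))) = x
      rw [hjk _ (T.α_mem_of_mem_ker hC hK x.2), add_comm, T.retract, hρL])
  let _ : TopologicalSpace (LinearMap.range b) := ⊥
  have : DiscreteTopology (LinearMap.range b) := ⟨rfl⟩
  let c : M →ₗ[R] LinearMap.range b := b.rangeRestrict ∘ₗ T.α
  have hc : Continuous c := by
    refine c.continuous_of_isOpen_ker ?_
    refine AddSubgroup.isOpen_mono (H₁ := (LinearMap.ker T.α).toAddSubgroup)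
      (H₂ := (LinearMap.ker c).toAddSubgroup) ?_ T.isOpen_ker
    intro x hx
    have hx' : T.α x = 0 := hx
    change b.rangeRestrict (T.α x) = 0
    rw [hx', map_zero]
  have hγ : Continuous fun y : LinearMap.range b => T.γ y := continuous_of_discreteTopology
  let E : M ≃ₗ[R] LinearMap.range b × L := LinearEquiv.ofLinearMap (c.prod ρ)
    ((T.γ ∘ₗ (LinearMap.range b).subtype).coprod L.subtype) (by
      refine LinearMap.ext ?_
      rintro ⟨⟨_, y, rfl⟩, x, hx⟩
      have hx' : b (T.α x) = 0 := hx
      have h1 : b (T.α (T.γ (b y) + x)) = b y := by rw [map_add, map_add, hbα, hbb, hx', add_zero]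
      refine Prod.ext (Subtype.ext h1) (Subtype.ext ?_)
      change (T.γ (b y) + x) - T.γ (b (T.α (T.γ (b y) + x))) = x
      rw [h1, add_sub_cancel_left]) (by
      refine LinearMap.ext fun x => ?_
      change T.γ (b (T.α x)) + (x - T.γ (b (T.α x))) = x
      rw [add_sub_cancel])
  let E' : M ≃L[R] LinearMap.range b × L :=
    { E with
      continuous_toFun := hc.prodMk ((continuous_id.sub (hγ.comp hc)).subtype_mk _)
      continuous_invFun := (hγ.comp continuous_fst).add (continuous_subtype_val.comp continuous_snd) }
  exact ⟨LinearMap.range b, inferInstance, inferInstance, inferInstance, inferInstance,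
    inferInstance, Q, _, _, hQ,
    ⟨E'.trans ((ContinuousLinearEquiv.refl R (LinearMap.range b)).prodCongr e)⟩⟩

/-- Locally for the Nisnevich topology, a Tate module is elementary and has a coprojective lattice
containing a given submodule with finitely generated image in the discrete part. -/
theorem TateRetract.exists_isStratifiedEtale {R : Type u} [CommRing R] {M : Type v}
    [AddCommGroup M] [Module R M] [TopologicalSpace M] {P S : Type (max u v)} [AddCommGroup P]
    [Module R P] [Module.Projective R P] (T : TateRetract R M P S) {L : Submodule R M}
    (hL : (L.map T.α).FG) :
    ∃ (A : Type u) (_ : CommRing A) (_ : Algebra R A), IsStratifiedEtale R A ∧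
      IsElementaryTate A (CompletedTensor R A M) ∧
      ∃ L' : Submodule A (CompletedTensor R A M),
        IsCoprojectiveLattice L' ∧ CompletedTensor.ofSubmodule A L ≤ L' := by
  obtain ⟨C, hCfg, hC⟩ := T.exists_fg_α_δ_mem
  -- The idempotent is made to kill `C`, which gives `bαδ = 0`, and the image of `L`, so that the
  -- kernel of `bα` contains the image of the completed base change of `L`.
  obtain ⟨A, _, _, hA, b, hb, hbα, hbC, hK⟩ :=
    exists_idempotent_of_almost_idempotent (a := T.α ∘ₗ T.γ) (Submodule.FG.sup hCfg hL) (by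
      intro y
      refine Submodule.mem_sup_left ?_
      have h1 := congrArg T.α (T.retract (T.γ y))
      rw [map_add] at h1
      rw [LinearMap.comp_apply, LinearMap.comp_apply, sub_eq_of_eq_add' h1.symm]
      exact hC _)
  have hkill : ∀ x ∈ (C ⊔ L.map T.α).baseChange A, b x = 0 := by
    intro x hx
    rw [Submodule.baseChange_eq_span] at hx
    induction hx using Submodule.span_induction with
    | mem x hx =>
      obtain ⟨y, hy, rfl⟩ := hx
      exact hbC y hy
    | zero => simp
    | add x y _ _ hx hy => rw [map_add, hx, hy, add_zero]
    | smul c x _ hx => rw [map_smul, hx, smul_zero]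
  have hbα' : ∀ y, b ((T.baseChange A).α ((T.baseChange A).γ y)) = b y := fun y => by
    rw [baseChange_α_γ]
    exact LinearMap.congr_fun hbα y
  have hbδ : ∀ f, b ((T.baseChange A).α ((T.baseChange A).δ f)) = 0 := fun f =>
    hkill _ (T.baseChange_α_δ_mem A (fun f => Submodule.mem_sup_left (hC f)) f)
  have hK' : ∃ K : Submodule A (A ⊗[R] P), K.FG ∧
      ∀ y, (T.baseChange A).α ((T.baseChange A).γ y) - b y ∈ K := by
    obtain ⟨K, hKfg, hK⟩ := hK
    refine ⟨K, hKfg, fun y => ?_⟩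
    rw [baseChange_α_γ]
    exact hK y
  refine ⟨A, _, _, hA, isElementaryTate (T := T.baseChange A) hb hbα' hbδ hK',
    LinearMap.ker (b ∘ₗ (T.baseChange A).α), isCoprojectiveLattice_ker hb hbα' hbδ hK', ?_⟩
  intro x hx
  have h1 := CompletedTensor.lift_mem_of_mem_ofSubmodule T.α T.isOpen_ker hx
  refine hkill _ ?_
  exact Submodule.baseChange_mono A le_sup_right h1

end CoprojectiveLattice

theorem mainTheorem3 {R : Type u} [CommRing R] {M : Type v} [AddCommGroup M] [Module R M]
    [TopologicalSpace M] [IsTopologicalAddGroup M] [ContinuousConstSMul R M] (hM : IsTate R M) :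
    (∃ (R' : Type u) (_ : CommRing R') (_ : Algebra R R'),
      IsNisnevichCovering (Spec.map (CommRingCat.ofHom (algebraMap R R'))) ∧
      IsElementaryTate R' (CompletedTensor R R' M) ∧
      ∃ L' : Submodule R' (CompletedTensor R R' M), IsCoprojectiveLattice L') ∧
    ∀ L : Submodule R M, IsLattice L →
      ∃ (R' : Type u) (_ : CommRing R') (_ : Algebra R R'),
        IsNisnevichCovering (Spec.map (CommRingCat.ofHom (algebraMap R R'))) ∧
        ∃ L' : Submodule R' (CompletedTensor R R' M),
          IsCoprojectiveLattice L' ∧ CompletedTensor.ofSubmodule R' L ≤ L' := by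
  obtain ⟨P, _, _, S, _, ⟨T⟩⟩ := hM.exists_tateRetract
  constructor
  -- The zero submodule need not be a lattice; only finite generation of its image in `P` is used.
  · obtain ⟨A, _, _, hA, hE, L', hL', -⟩ := T.exists_isStratifiedEtale (L := ⊥) (by
      rw [Submodule.map_bot]
      exact Submodule.fg_bot)
    exact ⟨A, _, _, hA.isNisnevichCovering, hE, L', hL'⟩
  · intro L hL
    obtain ⟨A, _, _, hA, -, L', hL', hLL'⟩ :=
      T.exists_isStratifiedEtale (T.fg_map_α_of_isLattice hL)
    exact ⟨A, _, _, hA.isNisnevichCovering, L', hL', hLL'⟩
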